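/- **Setting.** Let $\|\cdot\|$ be a norm on $\mathbb R^d$ that is invariant under sign changes of coordinates and normalized ($\|e_j\|=1$), $\kappa(x,y)=\|x-y\|$, $\mathcal B_d=\{x:\|x\|\le \frac12\}$, and $\Delta=\sup\{\kappa(x,y):x,y\in[0,1)^d\}$. Let $\mathcal P$ be a probability distribution on $\mathcal X\subseteq\mathcal B_d$. For $F\subseteq\mathcal B_d$ with $|F|=k\geq 1$ put $\kappa(x,F)=\min_{f\in F}\kappa(x,f)$ and $\mathrm{cost}_{\mathcal P}(F)=\mathbb E_{x\sim\mathcal P}\,\kappa(x,F)$ (statistical $k$-medians), and let $\mathrm{OPT}=\inf_F\mathrm{cost}_{\mathcal P}(F)$, assumed positive. For a set $D\supseteq\mathcal X$ (for instance $D=\mathcal B_d$), a (strong) $\varepsilon$-coreset of $\mathcal P$ in $D$ is a distribution $\mathcal P'$ on some $\mathcal X'\subseteq D$ with $(1-\varepsilon)\mathrm{cost}_{\mathcal P}(F)\le\mathrm{cost}_{\mathcal P'}(F)\le(1+\varepsilon)\mathrm{cost}_{\mathcal P}(F)$ for all $F\subseteq\mathcal B_d$, $|F|=k$; its size is $|\mathcal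 X'|$. A randomized algorithm $A$ taking $n$ i.i.d. samples and internal randomness $r$ is $\rho$-replicable if for every distribution $\mathcal Q$, $\Pr_{\bar X,\bar Y\sim \mathcal Q^n,\,r}[A(\bar X;r)=A(\bar Y;r)]\ge1-\rho$. **Heavy hitters.** $\mathrm{rHeavyHitters}(\mathcal Q,v,\eta,\rho',\delta')$, for $\mathcal Q$ on a finite domain $\mathcal Y$: let $m=\ln\frac{2}{\delta'(v-\eta)}/(v-\eta)$. If $|\mathcal Y|<m$ put $\hat{\mathcal Y}=\mathcal Y$, otherwise let $\hat{\mathcal Y}$ be the set of values of $\lceil m\rceil$ samples of $\mathcal Q$. Draw $\big\lceil(648\ln\frac2{\delta'}+648(|\hat{\mathcal Y}|+1)\ln2)/(\rho'^2\eta^2)\big\rceil$ fresh samples, choose $v'\in[v-\frac23\eta,v-\frac13\eta]$ uniformly at random, and return all $y\in\hat{\mathcal Y}$ with empirical mass at least $v'$. **Algorithm.** Inputs: $k$; $\varepsilon\in(0,1)$; $\rho\in(0,1)$; $\delta\in(0,\rho/3)$; an estimate $\Lambda$ of $\mathrm{OPT}$ with $\frac{\mathrm{OPT}}{\beta(1+\varepsilon)}\le\Lambda\le(1+\varepsilon)\mathrm{OPT}$,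 where $\beta\ge1$ is an absolute constant; and an upper bound $t\in\mathbb N$ on the number of layers, meaning $2^{-t+1}\Delta\le\frac{\varepsilon\Lambda}5$ and $t\le\big\lceil\log_2\frac{10\beta\Delta}{\varepsilon\,\mathrm{OPT}}+1\big\rceil$. Put $M=(2^5\Delta/\varepsilon)^d$ and $\gamma=\frac{\varepsilon}{5tkM\cdot2\Delta}$. Subdivide $[-\frac12,\frac12]^d$ at level $i$ into $2^{id}$ disjoint cells of side $2^{-i}$; a level $i$ cell is the parent of the $2^d$ level $i+1$ cells in it (its children). Let $\mathcal H[0]=\{[-\frac12,\frac12]^d\}$. For $i=1,2,\dots$, as long as $2^{-i+1}\Delta>\frac{\varepsilon\Lambda}5$, let $\mathcal H[i]$ be the set of children of cells of $\mathcal H[i-1]$ that are returned by $\mathrm{rHeavyHitters}(\mathcal P_i,v,\frac v2,\frac\rho t,\frac\delta t)$ with $v=\gamma\Lambda2^i$, run on fresh samples, where $\mathcal P_i$ is the discretization of $\mathcal P$ to the level $i$ cells; for all later $i$ put $\mathcal H[i]=\varnothing$. For $Z\in\mathcal H[j]$ define $R'(Z)=R'(Z')$ with $Z'$ a selected child of $Z$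 in $\mathcal H[j+1]$ if there is one, and otherwise let $R'(Z)$ be a selected point of $Z$. The selections follow an arbitrary fixed data-independent rule that, from a cell meeting $D$, selects a point of $D$. Output the map $R$ that sends $x$ to $R'(Z)$, where $Z$ is the deepest cell in $\bigcup_j\mathcal H[j]$ containing $x$. **Theorem.** For every $\beta\ge1$ there are constants $C,c$ depending only on $\beta$ such that, for all data as above: 1. the algorithm is $\rho$-replicable; 2. with probability at least $1-\delta$, the law $\mathcal P_R$ of $R(x)$, $x\sim\mathcal P$, on $R(\mathcal X)$ is an $\varepsilon$-coreset of $\mathcal P$ in $D$ for statistical $k$-medians, of size $$|R(\mathcal X)|\le C\,\frac{k\,2^{5d}\Delta^{d+1}}{\varepsilon^{d+1}}\log\frac{\Delta}{\varepsilon\,\mathrm{OPT}};$$ 3. the number of samples used is at most $C\,f\,(\log f)^c$ where $$f=\frac{k^3\,2^{15d}\Delta^{3d+3}}{\rho^2\varepsilon^{3d+3}\,\mathrm{OPT}^3}\log\frac1\delta .$$ -/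

import Mathlib

open MeasureTheory

noncomputable section

namespace QuadCoreset

/-! ### Norms, costs, coresets -/

/-- A norm on `ℝ^d` that is invariant under sign changes of coordinates and gives the canonical
basis vectors length one. -/
structure SignInvariantNorm (d : ℕ) extends Seminorm ℝ (Fin d → ℝ) where
  eq_zero_of_eq_zero : ∀ x : Fin d → ℝ, toFun x = 0 → x = 0
  sign_invariant : ∀ x s : Fin d → ℝ, (∀ j, s j = 1 ∨ s j = -1) →
    toFun (fun j => s j * x j) = toFun x
  normalized : ∀ j : Fin d, toFun (Pi.single j 1) = 1

variable {d : ℕ}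

/-- The metric `κ` induced by the norm. -/
def SignInvariantNorm.dist (N : SignInvariantNorm d) (x y : Fin d → ℝ) : ℝ :=
  N.toSeminorm (x - y)

/-- The ball of diameter `1` about the origin. -/
def SignInvariantNorm.ball (N : SignInvariantNorm d) : Set (Fin d → ℝ) :=
  {x | N.dist x 0 ≤ 1 / 2}

/-- `Δ`, the diameter of the unit hypercube `[0,1)^d`. -/
def SignInvariantNorm.diam (N : SignInvariantNorm d) : ℝ :=
  sSup {r | ∃ x y : Fin d → ℝ, (∀ j, x j ∈ Set.Ico (0 : ℝ) 1) ∧ (∀ j, y j ∈ Set.Ico (0 : ℝ) 1) ∧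
    r = N.dist x y}

/-- Distance from a point to the nearest point of a (nonempty) finite set of centers. -/
def SignInvariantNorm.distTo (N : SignInvariantNorm d) (x : Fin d → ℝ)
    (F : Finset (Fin d → ℝ)) : ℝ :=
  ⨅ f : F, N.dist x f

/-- Statistical `k`-medians cost of a set of centers. -/
def cost (N : SignInvariantNorm d) (P : Measure (Fin d → ℝ)) (F : Finset (Fin d → ℝ)) : ℝ :=
  ∫ x, N.distTo x F ∂P

/-- The optimal statistical `k`-medians cost. -/
def opt (N : SignInvariantNorm d) (P : Measure (Fin d → ℝ)) (k : ℕ) : ℝ :=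
  sInf {r | ∃ F : Finset (Fin d → ℝ), (F : Set (Fin d → ℝ)) ⊆ N.ball ∧ F.card = k ∧
    r = cost N P F}

/-- `P'` is a probability distribution on `X' ⊆ D` which is a strong `ε`-coreset of `P` for
`k`-medians (the usual ambient region is `D = N.ball`). -/
def IsCoreset (N : SignInvariantNorm d) (D : Set (Fin d → ℝ)) (k : ℕ) (ε : ℝ)
    (P P' : Measure (Fin d → ℝ)) (X' : Set (Fin d → ℝ)) : Prop :=
  IsProbabilityMeasure P' ∧ X' ⊆ D ∧ (∀ᵐ x ∂P', x ∈ X') ∧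
    ∀ F : Finset (Fin d → ℝ), (F : Set (Fin d → ℝ)) ⊆ N.ball → F.card = k →
      (1 - ε) * cost N P F ≤ cost N P' F ∧ cost N P' F ≤ (1 + ε) * cost N P F

/-! ### Replicability -/

/-- A randomized algorithm `A`, receiving a family of samples indexed by the finite type `ι` and
internal randomness of law `U`, is `ρ`-replicable if, for every distribution `P`, two runs on
independent i.i.d. samples from `P` with the same internal randomness
differ with probability at most `ρ`. -/
def IsReplicable {ι X Ω Y : Type*} [Fintype ι] [MeasurableSpace X] [MeasurableSpace Ω]
    (U : Measure Ω) (A : (ι → X) → Ω → Y) (ρ : ℝ) : Prop :=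
  ∀ P : Measure X, IsProbabilityMeasure P →
    (((Measure.pi fun _ : ι => P).prod (Measure.pi fun _ : ι => P)).prod U)
      {w | A w.1.1 w.2 ≠ A w.1.2 w.2} ≤ ENNReal.ofReal ρ

/-! ### Replicable heavy hitters on a finite domain -/

section HeavyHitters

variable {α : Type*} [DecidableEq α]

/-- The (real) number of samples needed to see all heavy hitters. -/
def candReal (v ε δ : ℝ) : ℝ := Real.log (2 / (δ * (v - ε))) / (v - ε)

/-- Number of samples drawn in order to find candidates: none if the domain is small. -/
def candCount (dom : Finset α) (v ε δ : ℝ) : ℕ :=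
  if (dom.card : ℝ) < candReal v ε δ then 0 else ⌈candReal v ε δ⌉₊

/-- The candidate set: the whole domain if it is small, otherwise the set of sampled points. -/
def candidates (dom : Finset α) (v ε δ : ℝ) (x : Fin (candCount dom v ε δ) → α) : Finset α :=
  if (dom.card : ℝ) < candReal v ε δ then dom else Finset.univ.image x

/-- The largest possible number of candidates. -/
def candBound (dom : Finset α) (v ε δ : ℝ) : ℕ :=
  if (dom.card : ℝ) < candReal v ε δ then dom.card else ⌈candReal v ε δ⌉₊

/-- Number of samples drawn in order to estimate the masses of `n` candidates. -/
def massCount (ρ ε δ : ℝ) (n : ℕ) : ℕ :=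
  ⌈(648 * Real.log (2 / δ) + 648 * ((n : ℝ) + 1) * Real.log 2) / (ρ ^ 2 * ε ^ 2)⌉₊

/-- Empirical mass of `c` in the first `n` entries of `y`. -/
def empirical {m : ℕ} (n : ℕ) (y : Fin m → α) (c : α) : ℝ :=
  ((Finset.univ.filter fun j : Fin m => (j : ℕ) < n ∧ y j = c).card : ℝ) / n

/-- Replicable heavy hitters with target `v`, error `ε`, replicability `ρ` and confidence `δ`.
Here `x` are the samples of the first phase, `y` the samples available to the second phase
(of which the first `massCount ρ ε δ |candidates|` are used), and `u`, which is to be uniform in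
`[0,1]`, produces the uniform threshold `v' ∈ [v - 2ε/3, v - ε/3]`. -/
def heavyHitters (dom : Finset α) (v ε ρ δ : ℝ) (x : Fin (candCount dom v ε δ) → α)
    (y : Fin (massCount ρ ε δ (candBound dom v ε δ)) → α) (u : ℝ) : Finset α :=
  (candidates dom v ε δ x).filter fun c =>
    v - 2 / 3 * ε + u * (ε / 3) ≤ empirical (massCount ρ ε δ (candidates dom v ε δ x).card) y c

end HeavyHitters

/-! ### Dyadic grids -/

/-- Index of a cell of a dyadic grid. -/
abbrev Cell (d : ℕ) := Fin d → ℕ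

/-- Indices of the `2^(i d)` cells of side `2^(-i)` that subdivide `[-1/2, 1/2]^d`. -/
def grid (d i : ℕ) : Finset (Cell d) := Fintype.piFinset fun _ => Finset.range (2 ^ i)

/-- The level `i` cell of `x`. Cells are products of half-open intervals, except that the last
interval of each axis contains its right end. -/
def cellOf (i : ℕ) (x : Fin d → ℝ) : Cell d := fun j => min ⌊(x j + 1 / 2) * 2 ^ i⌋₊ (2 ^ i - 1)

/-- The level `i` cell of index `c`, as a subset of `[-1/2, 1/2]^d`. -/
def region (d i : ℕ) (c : Cell d) : Set (Fin d → ℝ) :=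
  {x | (∀ j, x j ∈ Set.Icc (-(1 / 2) : ℝ) (1 / 2)) ∧ cellOf i x = c}

/-- The cell of the previous level which contains a given cell. -/
def parent (c : Cell d) : Cell d := fun j => c j / 2

/-- The children, at level `i + 1`, of a set of level `i` cells. -/
def children (i : ℕ) (s : Finset (Cell d)) : Finset (Cell d) :=
  (grid d (i + 1)).filter fun c => parent c ∈ s

/-- A data-independent rule that selects a point of a given cell and a member of a given
nonempty finite set of cells. A point of `D` is selected from each cell that meets `D`;
`D = Set.univ` imposes no condition. -/
structure ChoiceRule (d : ℕ) (D : Set (Fin d → ℝ)) where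
  pt : ℕ → Cell d → Fin d → ℝ
  pt_mem_region : ∀ i, ∀ c ∈ grid d i, pt i c ∈ region d i c
  pt_mem_of_nonempty : ∀ i, ∀ c ∈ grid d i, (region d i c ∩ D).Nonempty → pt i c ∈ D
  child : ℕ → Finset (Cell d) → Cell d
  child_mem : ∀ i s, s.Nonempty → child i s ∈ s

/-! ### The replicable coreset algorithm, for exponent `p = 1` -/

/-- The inputs of the algorithm: number of centers `k`, bound `t` on the number of layers,
accuracy `ε`, replicability `ρ`, confidence `δ`, and estimate `Λ` of the optimal cost. -/
structure Params where
  k : ℕ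
  t : ℕ
  ε : ℝ
  ρ : ℝ
  δ : ℝ
  Λ : ℝ

/-- The parameter `γ = ε / (5 t k M (2Δ))` with `M = (2^5 Δ / ε)^d`. -/
def gamma (N : SignInvariantNorm d) (a : Params) : ℝ :=
  a.ε / (5 * a.t * a.k * (2 ^ 5 / a.ε * N.diam) ^ d * (2 * N.diam))

/-- The heavy hitter threshold `v = γ Λ / 2^(-i)` of level `i`. -/
def target (N : SignInvariantNorm d) (a : Params) (i : ℕ) : ℝ := gamma N a * a.Λ * 2 ^ i

/-- The levels `i ≥ 1` at which heavy hitters are computed, namely those with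
`2^(-i+1) Δ > ε Λ / 5`. -/
def testedLevels (N : SignInvariantNorm d) (a : Params) : Finset ℕ :=
  (Finset.Icc 1 a.t).filter fun i => a.ε * a.Λ / 5 < (2 : ℝ) ^ (1 - (i : ℤ)) * N.diam

/-- The number of samples of the first phase of the heavy hitters call at level `i`. -/
def levelCand (N : SignInvariantNorm d) (a : Params) (i : ℕ) : ℕ :=
  candCount (grid d i) (target N a i) (target N a i / 2) (a.δ / a.t)

/-- The number of samples available to the second phase of the heavy hitters call at level `i`. -/
def levelMass (N : SignInvariantNorm d) (a : Params) (i : ℕ) : ℕ :=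
  massCount (a.ρ / a.t) (target N a i / 2) (a.δ / a.t)
    (candBound (grid d i) (target N a i) (target N a i / 2) (a.δ / a.t))

/-- The index set of the samples: every heavy hitters call gets fresh samples for its two phases.
Its cardinality is the number of samples of the algorithm. -/
abbrev SampleIdx (N : SignInvariantNorm d) (a : Params) : Type :=
  Σ i : testedLevels N a, Fin (levelCand N a i) ⊕ Fin (levelMass N a i)

/-- The internal randomness: one number for each heavy hitters call. -/
abbrev Seed (N : SignInvariantNorm d) (a : Params) : Type := testedLevels N a → ℝ

/-- The law of the internal randomness: independent uniform numbers in `[0,1]`. -/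
def seedLaw (N : SignInvariantNorm d) (a : Params) : Measure (Seed N a) :=
  Measure.pi fun _ => (volume : Measure ℝ).restrict (Set.Icc 0 1)

/-- The heavy hitters call at level `i`, on the discretization of the distribution to the cells
of level `i`. -/
def levelHeavy (N : SignInvariantNorm d) (a : Params) (x : SampleIdx N a → Fin d → ℝ)
    (u : Seed N a) (i : testedLevels N a) : Finset (Cell d) :=
  heavyHitters (grid d i) (target N a i) (target N a i / 2) (a.ρ / a.t) (a.δ / a.t)
    (fun j => cellOf i (x ⟨i, Sum.inl j⟩)) (fun j => cellOf i (x ⟨i, Sum.inr j⟩)) (u i)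

/-- The heavy cells `H[i]`. The recursion stops at the first level which is not tested: its cells
with heavy parents are the special cells. The cells of `children (H[i]) \ H[i+1]` at the other
levels are the light cells with heavy parents. -/
def heavyCells (N : SignInvariantNorm d) (a : Params) (x : SampleIdx N a → Fin d → ℝ)
    (u : Seed N a) : ℕ → Finset (Cell d)
  | 0 => grid d 0
  | i + 1 =>
    if h : i + 1 ∈ testedLevels N a then
      children i (heavyCells N a x u i) ∩ levelHeavy N a x u ⟨i + 1, h⟩
    else ∅

/-- The representative `R'(Z)` of a heavy cell `Z` of level `j`: descend along heavy children
until there are none, then choose a point. The first argument bounds the number of steps. -/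
def cellRep {D : Set (Fin d → ℝ)} (ch : ChoiceRule d D) (H : ℕ → Finset (Cell d)) :
    ℕ → ℕ → Cell d → Fin d → ℝ
  | 0, j, Z => ch.pt j Z
  | n + 1, j, Z =>
    if (children j {Z} ∩ H (j + 1)).Nonempty then
      cellRep ch H n (j + 1) (ch.child (j + 1) (children j {Z} ∩ H (j + 1)))
    else ch.pt j Z

/-- The replicable coreset algorithm. Its output is the map `R` which sends a point `y` to the
representative of the deepest heavy cell that contains `y`, that is, of the parent of the light or
special cell that contains `y`. -/
def rCoreset (N : SignInvariantNorm d) (a : Params) {D : Set (Fin d → ℝ)} (ch : ChoiceRule d D)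
    (x : SampleIdx N a → Fin d → ℝ) (u : Seed N a) : (Fin d → ℝ) → Fin d → ℝ :=
  fun y =>
    let j := Nat.findGreatest (fun j => cellOf j y ∈ heavyCells N a x u j) a.t
    cellRep ch (heavyCells N a x u) a.t j (cellOf j y)

end QuadCoreset

end

open QuadCoreset

namespace QuadCoreset

variable {d : ℕ}

/-! ### Sign-invariant norms -/

namespace SignInvariantNorm

/-! Coreset. Since `κ(·, F)` is 1-Lipschitz, replacing `P` by the law of `R(x)` changes the cost of
`F` by at most the mean displacement `E κ(x, R(x))`, so it suffices to bound this by `ε cost(F)` for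
every `F`. If the deepest heavy cell containing `x` has level `j`, then `x` moves by at most `2^(-j)
Δ`, and its cell of level `j + 1` is not heavy. Either that level is not tested, and `2^(-j) Δ ≤
εΛ/5`; or the cell is far from `F`, and the displacement is at most `(ε/5) κ(x, F)`; or the cell is
light and near `F`. A packing bound allows at most `kM` near cells per level, and `γ` is chosen so
that the light ones contribute at most `εΛ/5` over all `t` levels. As `Λ ≤ 2 cost(F)`, the total is
at most `(2/5 + 1/5 + 2/5) ε cost(F)`. See `IsCellTree.dist_repMap_le_displacementBound` and
`integral_displacementBound_le`.

Size. `R` takes at most one value per leaf of the tree of heavy cells. For a near-optimal `F`,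
leaves near `F` are counted by packing. Leaves far from `F` are disjoint and heavy, so each adds a
fixed amount to a cost below `2 OPT` (`IsCellTree.card_farLeaves_le`).

Replicability. The data enter only through the heavy hitters calls. Hoeffding's inequality and a
union bound over subsets control the `ℓ¹` error of the empirical masses. Two accurate runs then
differ only if the shared random threshold separates the two empirical masses of some candidate, and
the total length of these gaps is small (`measure_heavyHitters_ne_le`).

Samples. All counts are governed by `1/(γΛ)`, which is at most `20 β t A` with `A = k M Δ / (ε
OPT)`; the powers of `t` are absorbed into logarithms (`sample_bound`). -/

lemma dist_nonneg (N : SignInvariantNorm d) (x y : Fin d → ℝ) : 0 ≤ N.dist x y :=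
  apply_nonneg N.toSeminorm _

lemma dist_comm (N : SignInvariantNorm d) (x y : Fin d → ℝ) : N.dist x y = N.dist y x :=
  map_sub_rev N.toSeminorm x y

lemma dist_self (N : SignInvariantNorm d) (x : Fin d → ℝ) : N.dist x x = 0 := by
  simp [dist]

lemma dist_triangle (N : SignInvariantNorm d) (x y z : Fin d → ℝ) :
    N.dist x z ≤ N.dist x y + N.dist y z := by
  have := map_add_le_add N.toSeminorm (x - y) (y - z)
  simpa [dist] using this

/-- With `b = θ z_j` and `|θ| ≤ 1`, the updated vector is the convex combination, with weights `(1 ±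
θ)/2`, of `z` and its reflection in coordinate `j`, which have equal norm. -/
lemma update_le (N : SignInvariantNorm d) (z : Fin d → ℝ) (j : Fin d) {b : ℝ}
    (hb : |b| ≤ |z j|) : N.toSeminorm (Function.update z j b) ≤ N.toSeminorm z := by
  obtain ⟨θ, hθ, rfl⟩ : ∃ θ : ℝ, |θ| ≤ 1 ∧ b = θ * z j := by
    by_cases hz : z j = 0
    · refine ⟨0, by simp, ?_⟩
      simpa [hz] using hb
    · refine ⟨b / z j, ?_, by field_simp⟩
      rw [abs_div]
      exact div_le_one_of_le₀ hb (abs_nonneg _)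
  have hflip := N.sign_invariant z (Function.update 1 j (-1)) fun l => by
    by_cases hl : l = j
    · subst hl; simp
    · simp [hl]
  have hsplit : Function.update z j (θ * z j) = ((1 + θ) / 2) • z +
      ((1 - θ) / 2) • (fun l => Function.update (1 : Fin d → ℝ) j (-1) l * z l) := by
    ext l
    by_cases hl : l = j
    · subst hl; simp; ring
    · simp [hl]; ring
  obtain ⟨h1, h2⟩ := abs_le.mp hθ
  rw [hsplit]
  refine (map_add_le_add _ _ _).trans ?_
  rw [map_smul_eq_mul, map_smul_eq_mul, Real.norm_eq_abs, Real.norm_eq_abs,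
    abs_of_nonneg (by linarith), abs_of_nonneg (by linarith)]
  have hflip' : N.toSeminorm (fun l => Function.update (1 : Fin d → ℝ) j (-1) l * z l) =
      N.toSeminorm z := hflip
  rw [hflip']
  apply le_of_eq; ring

/-- Coordinates are shrunk one at a time by `update_le`. This monotonicity is the only form in which
sign invariance is used later. -/
lemma mono_abs (N : SignInvariantNorm d) {x y : Fin d → ℝ} (h : ∀ j, |x j| ≤ |y j|) :
    N.toSeminorm x ≤ N.toSeminorm y := by
  have key : ∀ s : Finset (Fin d),
      N.toSeminorm (fun j => if j ∈ s then x j else y j) ≤ N.toSeminorm y := by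
    intro s
    induction s using Finset.induction_on with
    | empty => simp
    | insert j s hj ih =>
      refine le_trans (le_of_eq_of_le ?_ (N.update_le (fun j => if j ∈ s then x j else y j) j
        (b := x j) (by simpa [hj] using h j))) ih
      congr 1
      ext l
      by_cases hl : l = j
      · subst hl; simp
      · simp [hl]
  simpa using key Finset.univ

lemma abs_coord_le (N : SignInvariantNorm d) (x : Fin d → ℝ) (j : Fin d) :
    |x j| ≤ N.toSeminorm x := by
  have h1 : N.toSeminorm (Pi.single j (x j)) ≤ N.toSeminorm x := by
    apply N.mono_abs
    intro l
    by_cases hl : l = j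
    · subst hl; simp
    · simp [hl]
  have h2 : (Pi.single j (x j) : Fin d → ℝ) = x j • (Pi.single j 1 : Fin d → ℝ) := by
    ext l
    by_cases hl : l = j
    · subst hl; simp
    · simp [hl]
  have h3 : N.toSeminorm (Pi.single j 1) = 1 := N.normalized j
  rwa [h2, map_smul_eq_mul, h3, mul_one, Real.norm_eq_abs] at h1

lemma abs_sub_le (N : SignInvariantNorm d) (x y : Fin d → ℝ) (j : Fin d) :
    |x j - y j| ≤ N.dist x y := N.abs_coord_le (x - y) j

/-- The supremum over the half-open cube is approached along `s • 1` and `0` as `s → 1`;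
monotonicity gives the upper bound. -/
lemma diam_eq (N : SignInvariantNorm d) : N.diam = N.toSeminorm 1 := by
  have hub : ∀ r ∈ {r | ∃ x y : Fin d → ℝ, (∀ j, x j ∈ Set.Ico (0 : ℝ) 1) ∧
      (∀ j, y j ∈ Set.Ico (0 : ℝ) 1) ∧ r = N.dist x y}, r ≤ N.toSeminorm 1 := by
    rintro r ⟨x, y, hx, hy, rfl⟩
    apply N.mono_abs
    intro j
    have hx := hx j
    have hy := hy j
    simp only [Set.mem_Ico] at hx hy
    simp only [Pi.sub_apply, Pi.one_apply, abs_one]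
    exact abs_le.mpr ⟨by linarith, by linarith⟩
  apply le_antisymm
  · refine csSup_le ⟨0, 0, 0, by simp, by simp, by simp [dist]⟩ hub
  · have hs : ∀ s ∈ Set.Ico (0 : ℝ) 1, s * N.toSeminorm 1 ≤ N.diam := by
      intro s hs
      refine le_csSup ⟨_, hub⟩ ⟨s • 1, 0, by simpa using fun _ => hs, by simp, ?_⟩
      simp [dist, map_smul_eq_mul, abs_of_nonneg hs.1]
    have hc : Filter.Tendsto (fun s : ℝ => s * N.toSeminorm 1) (nhdsWithin 1 (Set.Iio 1))
        (nhds (1 * N.toSeminorm 1)) :=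
      ((continuous_id.mul continuous_const).tendsto 1).mono_left nhdsWithin_le_nhds
    rw [one_mul] at hc
    refine le_of_tendsto hc ?_
    filter_upwards [Ico_mem_nhdsLT (show (0 : ℝ) < 1 by norm_num)] with s h using hs s h

lemma le_mul_diam (N : SignInvariantNorm d) {x : Fin d → ℝ} {r : ℝ} (h : ∀ j, |x j| ≤ r)
    (hr : 0 ≤ r) : N.toSeminorm x ≤ r * N.diam := by
  have : N.toSeminorm x ≤ N.toSeminorm (r • (1 : Fin d → ℝ)) := by
    apply N.mono_abs
    intro j
    simpa [abs_of_nonneg hr] using h j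
  rwa [map_smul_eq_mul, Real.norm_eq_abs, abs_of_nonneg hr, ← N.diam_eq] at this

lemma one_le_diam (N : SignInvariantNorm d) (hd : 0 < d) : 1 ≤ N.diam := by
  have := N.abs_coord_le 1 ⟨0, hd⟩
  rw [N.diam_eq]
  simpa using this

lemma ball_subset_cube (N : SignInvariantNorm d) {x : Fin d → ℝ} (hx : x ∈ N.ball) (j : Fin d) :
    x j ∈ Set.Icc (-(1 / 2) : ℝ) (1 / 2) := by
  have h := (N.abs_sub_le x 0 j).trans hx
  simpa [abs_le] using h

lemma dist_le_of_mem_ball (N : SignInvariantNorm d) {x y : Fin d → ℝ} (hx : x ∈ N.ball)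
    (hy : y ∈ N.ball) : N.dist x y ≤ 1 := by
  have h := N.dist_triangle x 0 y
  have hx : N.dist x 0 ≤ 1 / 2 := hx
  have hy : N.dist y 0 ≤ 1 / 2 := hy
  rw [N.dist_comm 0 y] at h
  linarith

lemma distTo_le (N : SignInvariantNorm d) (x : Fin d → ℝ) {F : Finset (Fin d → ℝ)}
    {f : Fin d → ℝ} (hf : f ∈ F) : N.distTo x F ≤ N.dist x f :=
  ciInf_le (f := fun f : F => N.dist x f) (Set.finite_range _).bddBelow ⟨f, hf⟩

lemma exists_distTo_eq (N : SignInvariantNorm d) (x : Fin d → ℝ) {F : Finset (Fin d → ℝ)}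
    (hF : F.Nonempty) : ∃ f ∈ F, N.distTo x F = N.dist x f := by
  have : Nonempty F := hF.to_subtype
  obtain ⟨f, hf⟩ := exists_eq_ciInf_of_finite (f := fun f : F => N.dist x f)
  exact ⟨f, f.2, hf.symm⟩

lemma distTo_nonneg (N : SignInvariantNorm d) (x : Fin d → ℝ) (F : Finset (Fin d → ℝ)) :
    0 ≤ N.distTo x F := Real.iInf_nonneg fun _ => N.dist_nonneg _ _

lemma distTo_le_add (N : SignInvariantNorm d) (x y : Fin d → ℝ) {F : Finset (Fin d → ℝ)}
    (hF : F.Nonempty) : N.distTo x F ≤ N.dist x y + N.distTo y F := by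
  obtain ⟨f, hf, h⟩ := N.exists_distTo_eq y hF
  rw [h]
  exact (N.distTo_le x hf).trans (N.dist_triangle x y f)

lemma continuous_distTo (N : SignInvariantNorm d) {F : Finset (Fin d → ℝ)} (hF : F.Nonempty) :
    Continuous fun x => N.distTo x F := by
  have hd : 0 ≤ N.diam := N.diam_eq ▸ apply_nonneg _ _
  refine LipschitzWith.continuous (K := N.diam.toNNReal) (LipschitzWith.of_le_add_mul _ ?_)
  intro x y
  have h1 := N.distTo_le_add x y hF
  have h2 : N.dist x y ≤ Dist.dist x y * N.diam := by
    refine N.le_mul_diam (fun j => ?_) _root_.dist_nonneg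
    simpa [Real.dist_eq] using dist_le_pi_dist x y j
  rw [Real.coe_toNNReal _ hd]
  linarith

lemma distTo_le_one (N : SignInvariantNorm d) {x : Fin d → ℝ} {F : Finset (Fin d → ℝ)}
    (hx : x ∈ N.ball) (hF : F.Nonempty) (hFB : (F : Set (Fin d → ℝ)) ⊆ N.ball) :
    N.distTo x F ≤ 1 := by
  obtain ⟨f, hf⟩ := hF
  exact (N.distTo_le x hf).trans (N.dist_le_of_mem_ball hx (hFB hf))

end SignInvariantNorm

/-! ### Costs and the optimal cost. -/

lemma integrable_distTo (N : SignInvariantNorm d) {P : Measure (Fin d → ℝ)}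
    [IsProbabilityMeasure P] (hP : ∀ᵐ x ∂P, x ∈ N.ball) {F : Finset (Fin d → ℝ)}
    (hF : F.Nonempty) (hFB : (F : Set (Fin d → ℝ)) ⊆ N.ball) :
    Integrable (fun x => N.distTo x F) P := by
  refine Integrable.of_bound (C := 1) (N.continuous_distTo hF).aestronglyMeasurable ?_
  filter_upwards [hP] with x hx
  rw [Real.norm_eq_abs, abs_of_nonneg (N.distTo_nonneg _ _)]
  exact N.distTo_le_one hx hF hFB

lemma cost_nonneg (N : SignInvariantNorm d) (P : Measure (Fin d → ℝ))
    (F : Finset (Fin d → ℝ)) : 0 ≤ cost N P F :=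
  integral_nonneg fun _ => N.distTo_nonneg _ _

lemma opt_le_cost (N : SignInvariantNorm d) (P : Measure (Fin d → ℝ)) {k : ℕ}
    {F : Finset (Fin d → ℝ)} (hFB : (F : Set (Fin d → ℝ)) ⊆ N.ball) (hF : F.card = k) :
    opt N P k ≤ cost N P F :=
  csInf_le ⟨0, by rintro r ⟨F, -, -, rfl⟩; exact cost_nonneg N P F⟩ ⟨F, hFB, hF, rfl⟩

lemma exists_cost_lt (N : SignInvariantNorm d) (P : Measure (Fin d → ℝ)) {k : ℕ}
    (hopt : 0 < opt N P k) : ∃ F : Finset (Fin d → ℝ), (F : Set (Fin d → ℝ)) ⊆ N.ball ∧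
      F.card = k ∧ cost N P F < 2 * opt N P k := by
  have hne : {r | ∃ F : Finset (Fin d → ℝ), (F : Set (Fin d → ℝ)) ⊆ N.ball ∧ F.card = k ∧
      r = cost N P F}.Nonempty := by
    -- The infimum of the empty set of reals is `0` by convention, so a positive optimum forces
    -- admissible center sets to exist.
    by_contra h
    rw [Set.not_nonempty_iff_eq_empty] at h
    rw [opt, h, Real.sInf_empty] at hopt
    exact lt_irrefl _ hopt
  obtain ⟨r, ⟨F, hFB, hF, rfl⟩, h⟩ := exists_lt_of_csInf_lt hne
    (show sInf _ < 2 * opt N P k by rw [← opt]; linarith)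
  exact ⟨F, hFB, hF, h⟩

/-- In dimension `0` all points coincide and every cost vanishes. Positive dimension is what gives
`Δ ≥ 1`. -/
lemma dim_pos_of_opt_pos (N : SignInvariantNorm d) (P : Measure (Fin d → ℝ)) {k : ℕ}
    (hk : 1 ≤ k) (hopt : 0 < opt N P k) : 0 < d := by
  rcases Nat.eq_zero_or_pos d with rfl | h
  · exfalso
    obtain ⟨F, hFB, hF, -⟩ := exists_cost_lt N P hopt
    have h := opt_le_cost N P hFB hF
    have h0 : cost N P F = 0 := by
      have : ∀ x, N.distTo x F = 0 := by
        intro x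
        have hne : F.Nonempty := Finset.card_pos.mp (by omega)
        obtain ⟨f, hf, h⟩ := N.exists_distTo_eq x hne
        rw [h, Subsingleton.elim f x, N.dist_self]
      simp [cost, this]
    linarith
  · exact h

/-- Any center set containing the origin costs at most the radius `1/2`. The bound makes `Δ / (ε
OPT) ≥ 2`, which keeps the logarithms away from zero. -/
lemma opt_le_half (N : SignInvariantNorm d) {P : Measure (Fin d → ℝ)} [IsProbabilityMeasure P]
    (hP : ∀ᵐ x ∂P, x ∈ N.ball) {k : ℕ} (hk : 1 ≤ k) (hd : 0 < d) : opt N P k ≤ 1 / 2 := by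
  -- Exactly `k` distinct centers are required: they are placed on one axis, within the ball, with
  -- `e 0` the origin.
  let e : ℕ → Fin d → ℝ := fun j => Pi.single (⟨0, hd⟩ : Fin d) ((j : ℝ) / (2 * k))
  have hk0 : (0 : ℝ) < k := by exact_mod_cast hk
  have he : Function.Injective e := by
    intro a b hab
    have h := congrFun hab ⟨0, hd⟩
    simp only [e, Pi.single_eq_same] at h
    field_simp at h
    exact_mod_cast h
  let F : Finset (Fin d → ℝ) := (Finset.range k).image e
  have hFc : F.card = k := by
    rw [Finset.card_image_of_injective _ he, Finset.card_range]
  have hFB : (F : Set (Fin d → ℝ)) ⊆ N.ball := by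
    intro x hx
    obtain ⟨j, hj, rfl⟩ := Finset.mem_image.mp (Finset.mem_coe.mp hx)
    have hj : (j : ℝ) ≤ k := by exact_mod_cast (Finset.mem_range.mp hj).le
    have h1 : e j = ((j : ℝ) / (2 * k)) • (Pi.single (⟨0, hd⟩ : Fin d) 1 : Fin d → ℝ) := by
      ext l
      by_cases hl : l = ⟨0, hd⟩
      · subst hl; simp [e]
      · simp [e, hl]
    have h2 : N.toSeminorm (Pi.single (⟨0, hd⟩ : Fin d) 1) = 1 := N.normalized _
    change N.toSeminorm (e j - 0) ≤ 1 / 2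
    rw [sub_zero, h1, map_smul_eq_mul, h2, mul_one, Real.norm_eq_abs,
      abs_of_nonneg (by positivity), div_le_div_iff₀ (by positivity) (by norm_num)]
    linarith
  refine (opt_le_cost N P hFB hFc).trans ?_
  have h0 : (0 : Fin d → ℝ) ∈ F := Finset.mem_image.mpr ⟨0, Finset.mem_range.mpr hk, by simp [e]⟩
  have hle : cost N P F ≤ ∫ _x, (1 / 2 : ℝ) ∂P := by
    refine integral_mono_ae (integrable_distTo N hP ⟨0, h0⟩ hFB) (integrable_const _) ?_
    filter_upwards [hP] with x hx
    exact (N.distTo_le x h0).trans hx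
  simpa using hle

/-! ### Dyadic cells -/

lemma cellOf_mem_grid (i : ℕ) (x : Fin d → ℝ) : cellOf i x ∈ grid d i := by
  rw [grid, Fintype.mem_piFinset]
  intro j
  have : 0 < 2 ^ i := by positivity
  simp only [cellOf, Finset.mem_range]
  omega

/-- Halving commutes with the floor and also with the cap, since `(2^(i+1) - 1) / 2 = 2^i - 1` in
integer division. -/
lemma parent_cellOf (i : ℕ) (x : Fin d → ℝ) : parent (cellOf (i + 1) x) = cellOf i x := by
  funext j
  have h : ⌊(x j + 1 / 2) * 2 ^ i⌋₊ = ⌊(x j + 1 / 2) * 2 ^ (i + 1)⌋₊ / 2 := by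
    rw [← Nat.floor_div_ofNat]
    congr 1
    rw [pow_succ]
    ring
  simp only [parent, cellOf, h, pow_succ]
  have : 0 < 2 ^ i := by positivity
  omega

/-- The cap on the index makes the last interval closed; it still has length one because the points
do not exceed `n`. -/
lemma abs_sub_le_of_min_floor_eq {a b : ℝ} {n : ℕ} (hn : 0 < n) (ha : a ∈ Set.Icc (0 : ℝ) n)
    (hb : b ∈ Set.Icc (0 : ℝ) n) (h : min ⌊a⌋₊ (n - 1) = min ⌊b⌋₊ (n - 1)) : |a - b| ≤ 1 := by
  have key : ∀ z ∈ Set.Icc (0 : ℝ) n, ((min ⌊z⌋₊ (n - 1) : ℕ) : ℝ) ≤ z ∧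
      z ≤ (min ⌊z⌋₊ (n - 1) : ℕ) + 1 := by
    intro z hz
    have h1 := Nat.floor_le hz.1
    have h2 := Nat.lt_floor_add_one z
    refine ⟨le_trans (by exact_mod_cast min_le_left _ _) h1, ?_⟩
    rcases le_total ⌊z⌋₊ (n - 1) with h | h
    · rw [min_eq_left h]; exact h2.le
    · rw [min_eq_right h]
      have := hz.2
      rw [Nat.cast_sub hn]
      simpa using this
  have h1 := key a ha
  have h2 := key b hb
  rw [h] at h1
  exact abs_le.mpr ⟨by linarith, by linarith⟩

lemma dist_le_of_cellOf_eq (N : SignInvariantNorm d) {i : ℕ} {x y : Fin d → ℝ}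
    (hx : ∀ j, x j ∈ Set.Icc (-(1 / 2) : ℝ) (1 / 2))
    (hy : ∀ j, y j ∈ Set.Icc (-(1 / 2) : ℝ) (1 / 2)) (h : cellOf i x = cellOf i y) :
    N.dist x y ≤ (2 ^ i)⁻¹ * N.diam := by
  refine N.le_mul_diam (fun j => ?_) (by positivity)
  have hp : (0 : ℝ) < 2 ^ i := by positivity
  have hc : ∀ z ∈ Set.Icc (-(1 / 2) : ℝ) (1 / 2),
      (z + 1 / 2) * 2 ^ i ∈ Set.Icc (0 : ℝ) ((2 ^ i : ℕ) : ℝ) := by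
    intro z hz
    obtain ⟨h1, h2⟩ := hz
    push_cast
    constructor
    · apply mul_nonneg <;> linarith
    · nlinarith
  have := abs_sub_le_of_min_floor_eq (Nat.pos_of_ne_zero (by positivity)) (hc _ (hx j)) (hc _ (hy j))
    (congrFun h j)
  rw [← sub_mul, abs_mul, abs_of_pos hp, add_sub_add_right_eq_sub] at this
  rw [Pi.sub_apply, inv_eq_one_div, le_div_iff₀ hp]
  exact this

lemma measurable_cellOf (i : ℕ) : Measurable (cellOf (d := d) i) := by
  refine measurable_pi_lambda _ fun j => ?_
  refine Measurable.min ?_ measurable_const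
  exact Nat.measurable_floor.comp (((measurable_pi_apply j).add_const _).mul_const _)

open scoped Classical in
/-- The cells of level `i` that have a point at distance less than `r` from `F`. -/
noncomputable def nearCells (N : SignInvariantNorm d) (F : Finset (Fin d → ℝ)) (i : ℕ) (r : ℝ) :
    Finset (Cell d) :=
  (grid d i).filter fun c => ∃ x, cellOf i x = c ∧ ∃ f ∈ F, N.dist x f < r

/-- Coordinates are bounded by the norm, so in units of the side length the cells near a center have
indices in a product of `d` integer intervals. -/
lemma card_nearCells_le (N : SignInvariantNorm d) {F : Finset (Fin d → ℝ)}
    (hF : (F : Set (Fin d → ℝ)) ⊆ N.ball) (i : ℕ) {L : ℝ} (hL : 0 ≤ L) :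
    ((nearCells N F i (L / 2 ^ i)).card : ℝ) ≤ F.card * (2 * L + 2) ^ d := by
  classical
  have hp : (0 : ℝ) < 2 ^ i := by positivity
  let p : (Fin d → ℝ) → Fin d → ℝ := fun f j => (f j + 1 / 2) * 2 ^ i
  let B : (Fin d → ℝ) → Finset (Cell d) := fun f => Fintype.piFinset fun j =>
    (Finset.Icc ⌊p f j - L⌋₊ ⌊p f j + L⌋₊).image fun n => min n (2 ^ i - 1)
  have hsub : nearCells N F i (L / 2 ^ i) ⊆ F.biUnion B := by
    intro c hc
    obtain ⟨-, x, rfl, f, hf, hx⟩ := Finset.mem_filter.mp hc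
    refine Finset.mem_biUnion.mpr ⟨f, hf, Fintype.mem_piFinset.mpr fun j => ?_⟩
    refine Finset.mem_image.mpr ⟨⌊(x j + 1 / 2) * 2 ^ i⌋₊, ?_, rfl⟩
    have h := (N.abs_sub_le x f j).trans_lt hx
    rw [lt_div_iff₀ hp] at h
    have h' : |(x j + 1 / 2) * 2 ^ i - p f j| < L := by
      have : (x j + 1 / 2) * 2 ^ i - p f j = (x j - f j) * 2 ^ i := by simp only [p]; ring
      rwa [this, abs_mul, abs_of_pos hp]
    rw [abs_lt] at h'
    exact Finset.mem_Icc.mpr ⟨Nat.floor_le_floor (by linarith), Nat.floor_le_floor (by linarith)⟩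
  have hB : ∀ f ∈ F, ((B f).card : ℝ) ≤ (2 * L + 2) ^ d := by
    intro f hf
    rw [Fintype.card_piFinset]
    push_cast
    refine (Finset.prod_le_prod (fun _ _ => by positivity) fun j _ => ?_).trans_eq
      (by simp : ∏ _j : Fin d, (2 * L + 2) = _)
    have hpos : 0 ≤ p f j := by
      have := (N.ball_subset_cube (hF hf) j).1
      exact mul_nonneg (by linarith) hp.le
    have h1 : ((⌊p f j + L⌋₊ : ℕ) : ℝ) ≤ p f j + L := Nat.floor_le (by linarith)
    -- Valid also for negative `p f j - L`, whose natural floor is `0`. The interval thus has at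
    -- most `(p + L) + 1 - (p - L - 1) = 2L + 2` integers.
    have h2 := Nat.lt_floor_add_one (p f j - L)
    have h3 : ⌊p f j - L⌋₊ ≤ ⌊p f j + L⌋₊ := Nat.floor_le_floor (by linarith)
    refine (Nat.cast_le.mpr Finset.card_image_le).trans ?_
    rw [Nat.card_Icc, Nat.cast_sub (by omega)]
    push_cast
    linarith
  calc ((nearCells N F i (L / 2 ^ i)).card : ℝ) ≤ ((F.biUnion B).card : ℝ) := by
        exact_mod_cast Finset.card_le_card hsub
    _ ≤ ∑ f ∈ F, ((B f).card : ℝ) := by exact_mod_cast Finset.card_biUnion_le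
    _ ≤ F.card * (2 * L + 2) ^ d := by
        simpa using Finset.sum_le_card_nsmul F _ _ hB

open ProbabilityTheory

/-! ### Product measures -/

/-- Conditioning on a variable with countably many values: summing over its fibers needs no
measurability of `Q`. It serves to condition on the candidates, and later on all discretized
samples. -/
lemma prod_le_of_forall_fiber {α β γ : Type*} [MeasurableSpace α] [MeasurableSpace β]
    [MeasurableSpace γ] [Countable γ] [MeasurableSingletonClass γ] (μ : Measure α)
    [IsProbabilityMeasure μ] (ν : Measure β) [SFinite ν] {f : α → γ} (hf : Measurable f)
    (Q : γ → β → Prop) {r : ENNReal} (h : ∀ g, ν {b | Q g b} ≤ r) :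
    (μ.prod ν) {w | Q (f w.1) w.2} ≤ r := by
  have hsub : {w : α × β | Q (f w.1) w.2} ⊆ ⋃ g, (f ⁻¹' {g}) ×ˢ {b | Q g b} := by
    intro w hw
    exact Set.mem_iUnion.mpr ⟨f w.1, rfl, hw⟩
  calc (μ.prod ν) {w | Q (f w.1) w.2} ≤ ∑' g, (μ.prod ν) ((f ⁻¹' {g}) ×ˢ {b | Q g b}) :=
        (measure_mono hsub).trans (measure_iUnion_le _)
    _ ≤ ∑' g, μ (f ⁻¹' {g}) * r := by
        refine ENNReal.tsum_le_tsum fun g => ?_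
        rw [Measure.prod_prod]
        gcongr
        exact h g
    _ = r := by
        rw [ENNReal.tsum_mul_right]
        have h1 : ∑' g, μ (f ⁻¹' {g}) = μ (⋃ g, f ⁻¹' {g}) := by
          refine (measure_iUnion (fun a b hab => ?_) fun g => hf (measurableSet_singleton g)).symm
          exact Disjoint.preimage f (by simpa using hab)
        rw [h1, ← Set.preimage_iUnion, Set.iUnion_of_singleton, Set.preimage_univ, measure_univ,
          one_mul]

/-- Distinct coordinates of a product are independent, so the discretized samples reserved for one
call are i.i.d. with the discretized law. -/
lemma measurePreserving_pi_comp {ι ι' α β : Type*} [Fintype ι] [Fintype ι'] [MeasurableSpace α]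
    [MeasurableSpace β] (P : Measure α) [IsProbabilityMeasure P] {e : ι' → ι}
    (he : Function.Injective e) {g : α → β} (hg : Measurable g) :
    MeasurePreserving (fun (x : ι → α) (j : ι') => g (x (e j))) (Measure.pi fun _ => P)
      (Measure.pi fun _ => P.map g) := by
  have hi : iIndepFun (fun (i : ι) (x : ι → α) => g (x i)) (Measure.pi fun _ : ι => P) :=
    iIndepFun_pi (X := fun _ => g) fun _ => hg.aemeasurable
  have hi' := hi.precomp he
  have hm : ∀ i : ι, Measurable fun x : ι → α => g (x i) :=
    fun i => hg.comp (measurable_pi_apply i)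
  refine ⟨measurable_pi_lambda _ fun j => hm (e j), ?_⟩
  rw [(iIndepFun_iff_map_fun_eq_pi_map fun j => (hm (e j)).aemeasurable).mp hi']
  congr 1
  funext j
  conv_rhs => rw [← (measurePreserving_eval (fun _ : ι => P) (e j)).map_eq]
  rw [Measure.map_map hg (measurable_pi_apply _)]
  rfl

lemma measurePreserving_pi_comp_sum {ι ι₁ ι₂ α β : Type*} [Fintype ι] [Fintype ι₁] [Fintype ι₂]
    [MeasurableSpace α] [MeasurableSpace β] (P : Measure α) [IsProbabilityMeasure P]
    {e : ι₁ ⊕ ι₂ → ι} (he : Function.Injective e) {g : α → β} (hg : Measurable g) :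
    MeasurePreserving
      (fun x : ι → α => ((fun j => g (x (e (Sum.inl j)))), (fun j => g (x (e (Sum.inr j))))))
      (Measure.pi fun _ => P)
      ((Measure.pi fun _ : ι₁ => P.map g).prod (Measure.pi fun _ : ι₂ => P.map g)) := by
  have : IsProbabilityMeasure (P.map g) := Measure.isProbabilityMeasure_map hg.aemeasurable
  exact (measurePreserving_sumPiEquivProdPi (X := fun _ : ι₁ ⊕ ι₂ => β)
    (fun _ => P.map g)).comp (measurePreserving_pi_comp P he hg)

/-! ### Concentration of empirical masses -/

/-- Only the first `n` of the `m` available samples are averaged, because the number used by the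
second phase depends on the candidate set. -/
lemma hoeffding_pi {α : Type*} [MeasurableSpace α] (Q : Measure α) [IsProbabilityMeasure Q]
    {g : α → ℝ} (hg : Measurable g) {a b : ℝ} (hab : b - a = 1) (hgab : ∀ x, g x ∈ Set.Icc a b)
    {m n : ℕ} (hnm : n ≤ m) (hn : 0 < n) {s : ℝ} (hs : 0 ≤ s) :
    (Measure.pi fun _ : Fin m => Q)
      {y | n * s ≤ ∑ j ∈ Finset.univ.filter (fun j : Fin m => (j : ℕ) < n), (g (y j) - ∫ x, g x ∂Q)}
      ≤ ENNReal.ofReal (Real.exp (-(2 * n * s ^ 2))) := by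
  have hi : iIndepFun (fun (j : Fin m) (y : Fin m → α) => g (y j) - ∫ x, g x ∂Q)
      (Measure.pi fun _ => Q) :=
    iIndepFun_pi (X := fun _ x => g x - ∫ x, g x ∂Q) fun _ => (hg.sub_const _).aemeasurable
  have hmean : ∀ j : Fin m, ∫ y, g (y j) ∂(Measure.pi fun _ : Fin m => Q) = ∫ x, g x ∂Q := by
    intro j
    exact integral_comp_eval (μ := fun _ : Fin m => Q) (i := j) hg.aestronglyMeasurable
  have hsub : ∀ j ∈ Finset.univ.filter (fun j : Fin m => (j : ℕ) < n),
      HasSubgaussianMGF (fun y : Fin m → α => g (y j) - ∫ x, g x ∂Q) ((‖b - a‖₊ / 2) ^ 2)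
        (Measure.pi fun _ => Q) := by
    intro j _
    have := hasSubgaussianMGF_of_mem_Icc (μ := Measure.pi fun _ : Fin m => Q)
      (X := fun y => g (y j)) (a := a) (b := b)
      (hg.comp (measurable_pi_apply j)).aemeasurable (Filter.Eventually.of_forall fun y => hgab _)
    rwa [hmean j] at this
  have h := HasSubgaussianMGF.measure_sum_ge_le_of_iIndepFun hi (c := fun _ => (‖b - a‖₊ / 2) ^ 2)
    hsub (ε := n * s) (by positivity)
  have hcard : (Finset.univ.filter fun j : Fin m => (j : ℕ) < n).card = n := by
    rw [Fin.card_filter_val_lt, min_eq_right hnm]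
  rw [← ENNReal.ofReal_toReal (measure_ne_top _ _)]
  refine ENNReal.ofReal_le_ofReal (h.trans (le_of_eq ?_))
  congr 1
  have hn' : (n : ℝ) ≠ 0 := by positivity
  simp only [hab, nnnorm_one, Finset.sum_const, hcard]
  push_cast
  rw [nsmul_eq_mul]
  field_simp

/-- The positive and the negative terms cannot both contribute less than half. This reduces an `ℓ¹`
deviation to deviations of the masses of subsets. -/
lemma half_le_sum_pos_or_neg {α : Type*} {S : Finset α} {g : α → ℝ} {τ : ℝ} (h : τ ≤ ∑ c ∈ S, |g c|) :
    ∃ T ∈ S.powerset, τ / 2 ≤ ∑ c ∈ T, g c ∨ τ / 2 ≤ -∑ c ∈ T, g c := by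
  classical
  have h1 : ∑ c ∈ S, |g c| = ∑ c ∈ S.filter (fun c => 0 ≤ g c), g c +
      -∑ c ∈ S.filter (fun c => ¬ 0 ≤ g c), g c := by
    rw [← Finset.sum_filter_add_sum_filter_not S (fun c => 0 ≤ g c), ← Finset.sum_neg_distrib]
    congr 1
    · refine Finset.sum_congr rfl fun c hc => abs_of_nonneg (Finset.mem_filter.mp hc).2
    · refine Finset.sum_congr rfl fun c hc => abs_of_neg (not_le.mp (Finset.mem_filter.mp hc).2)
  by_cases hp : τ / 2 ≤ ∑ c ∈ S.filter (fun c => 0 ≤ g c), g c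
  · exact ⟨_, Finset.mem_powerset.mpr (Finset.filter_subset _ _), Or.inl hp⟩
  · exact ⟨S.filter fun c => ¬ 0 ≤ g c, Finset.mem_powerset.mpr (Finset.filter_subset _ _),
      Or.inr (by linarith)⟩

section HeavyHitters

variable {α : Type*} [DecidableEq α]

lemma sum_empirical_eq {m : ℕ} (n : ℕ) (y : Fin m → α) (T : Finset α) :
    ∑ c ∈ T, empirical n y c = (∑ j ∈ Finset.univ.filter (fun j : Fin m => (j : ℕ) < n),
      Set.indicator (T : Set α) (fun _ => (1 : ℝ)) (y j)) / n := by
  simp only [empirical]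
  rw [← Finset.sum_div]
  congr 1
  have : ∀ c, ((Finset.univ.filter fun j : Fin m => (j : ℕ) < n ∧ y j = c).card : ℝ) =
      ∑ j ∈ Finset.univ.filter (fun j : Fin m => (j : ℕ) < n), if y j = c then 1 else 0 := by
    intro c
    rw [← Finset.filter_filter, Finset.card_filter]
    push_cast
    rfl
  simp_rw [this]
  rw [Finset.sum_comm]
  refine Finset.sum_congr rfl fun j _ => ?_
  simp [Set.indicator_apply]

lemma card_candidates_le (dom : Finset α) (v ε δ : ℝ) (x : Fin (candCount dom v ε δ) → α) :
    (candidates dom v ε δ x).card ≤ candBound dom v ε δ := by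
  unfold candidates candBound
  split_ifs with h
  · exact le_rfl
  · refine Finset.card_image_le.trans ?_
    rw [Finset.card_univ, Fintype.card_fin, candCount, if_neg h]

lemma massCount_mono {ρ ε δ : ℝ} {n n' : ℕ} (h : n ≤ n') :
    massCount ρ ε δ n ≤ massCount ρ ε δ n' := by
  refine Nat.ceil_le_ceil ?_
  have : (n : ℝ) ≤ n' := by exact_mod_cast h
  have := Real.log_pos (show (1 : ℝ) < 2 by norm_num)
  gcongr

variable [MeasurableSpace α]

lemma measure_empirical_dev_le [MeasurableSingletonClass α] (Q : Measure α) [IsProbabilityMeasure Q]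
    (T : Finset α) {m n : ℕ} (hnm : n ≤ m) (hn : 0 < n) {s : ℝ} (hs : 0 ≤ s) :
    (Measure.pi fun _ : Fin m => Q) {y | s ≤ ∑ c ∈ T, (empirical n y c - Q.real {c}) ∨
        s ≤ -∑ c ∈ T, (empirical n y c - Q.real {c})} ≤
      2 * ENNReal.ofReal (Real.exp (-(2 * n * s ^ 2))) := by
  have hT : MeasurableSet (T : Set α) := T.measurableSet
  have hn' : (0 : ℝ) < n := by exact_mod_cast hn
  have hint : ∫ x, Set.indicator (T : Set α) (fun _ => (1 : ℝ)) x ∂Q = ∑ c ∈ T, Q.real {c} := by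
    rw [integral_indicator_const _ hT, smul_eq_mul, mul_one, sum_measureReal_singleton]
  have hcard : (Finset.univ.filter fun j : Fin m => (j : ℕ) < n).card = n := by
    rw [Fin.card_filter_val_lt, min_eq_right hnm]
  have hg : Measurable (Set.indicator (T : Set α) fun _ => (1 : ℝ)) :=
    measurable_const.indicator hT
  have hg01 : ∀ x, Set.indicator (T : Set α) (fun _ => (1 : ℝ)) x ∈ Set.Icc (0 : ℝ) 1 := by
    intro x
    by_cases hx : x ∈ (T : Set α) <;> simp [hx]
  have h1 := hoeffding_pi Q hg (by norm_num) hg01 hnm hn hs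
  have h2 := hoeffding_pi Q hg.neg (a := -1) (b := 0) (by norm_num)
    (fun x => by have := hg01 x; simp only [Set.mem_Icc, Pi.neg_apply] at *; constructor <;> linarith)
    hnm hn hs
  have key : ∀ y : Fin m → α, n * ∑ c ∈ T, (empirical n y c - Q.real {c}) =
      ∑ j ∈ Finset.univ.filter (fun j : Fin m => (j : ℕ) < n),
        (Set.indicator (T : Set α) (fun _ => (1 : ℝ)) (y j) - ∑ c ∈ T, Q.real {c}) := by
    intro y
    rw [Finset.sum_sub_distrib, sum_empirical_eq, Finset.sum_sub_distrib, Finset.sum_const, hcard,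
      nsmul_eq_mul]
    field_simp
  have hneg : ∫ x, (-Set.indicator (T : Set α) (fun _ => (1 : ℝ))) x ∂Q = -∑ c ∈ T, Q.real {c} := by
    rw [← hint, ← integral_neg]
    rfl
  rw [hint] at h1
  rw [hneg] at h2
  rw [two_mul]
  refine (measure_mono (fun y hy => ?_)).trans ((measure_union_le _ _).trans (add_le_add h1 h2))
  rcases hy with hy | hy
  · left
    rw [Set.mem_ofPred_eq, ← key]
    exact mul_le_mul_of_nonneg_left hy hn'.le
  · right
    have := mul_le_mul_of_nonneg_left hy hn'.le
    rw [mul_neg, key, ← Finset.sum_neg_distrib] at this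
    refine this.trans (le_of_eq (Finset.sum_congr rfl fun j _ => ?_))
    simp only [Pi.neg_apply]
    ring

/-- A union bound over the `2^|S|` subsets, each with a two-sided Hoeffding bound at deviation
`ρε/36`; this is why `massCount` is linear in the number of candidates. -/
lemma measure_sum_abs_empirical_le [MeasurableSingletonClass α] (Q : Measure α) [IsProbabilityMeasure Q]
    (S : Finset α)
    {ρ ε δ : ℝ} (hρ : 0 < ρ) (hε : 0 < ε) (hδ : 0 < δ) (hδ1 : δ < 1) {m : ℕ}
    (hnm : massCount ρ ε δ S.card ≤ m) :
    (Measure.pi fun _ : Fin m => Q) {y | ρ * ε / 18 ≤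
        ∑ c ∈ S, |empirical (massCount ρ ε δ S.card) y c - Q.real {c}|} ≤
      ENNReal.ofReal (δ / 2) := by
  set n := massCount ρ ε δ S.card with hn
  have hlog : 0 < Real.log (2 / δ) := Real.log_pos (by rw [lt_div_iff₀ hδ]; linarith)
  have hlog2 : 0 < Real.log 2 := Real.log_pos (by norm_num)
  have hquot : 0 < (648 * Real.log (2 / δ) + 648 * ((S.card : ℝ) + 1) * Real.log 2) /
      (ρ ^ 2 * ε ^ 2) := by positivity
  have hnpos : 0 < n := Nat.ceil_pos.mpr hquot
  have hnle : (648 * Real.log (2 / δ) + 648 * ((S.card : ℝ) + 1) * Real.log 2) /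
      (ρ ^ 2 * ε ^ 2) ≤ n := Nat.le_ceil _
  have hs : 0 ≤ ρ * ε / 18 / 2 := by positivity
  have hsub : {y : Fin m → α | ρ * ε / 18 ≤ ∑ c ∈ S, |empirical n y c - Q.real {c}|} ⊆
      ⋃ T ∈ S.powerset, {y | ρ * ε / 18 / 2 ≤ ∑ c ∈ T, (empirical n y c - Q.real {c}) ∨
        ρ * ε / 18 / 2 ≤ -∑ c ∈ T, (empirical n y c - Q.real {c})} := by
    intro y hy
    obtain ⟨T, hT, h⟩ := half_le_sum_pos_or_neg (g := fun c => empirical n y c - Q.real {c}) hy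
    exact Set.mem_iUnion₂.mpr ⟨T, hT, h⟩
  have hexp : (2 : ℝ) ^ S.card * (2 * Real.exp (-(2 * n * (ρ * ε / 18 / 2) ^ 2))) ≤ δ / 2 := by
    -- Here `648 = 36² / 2`, so the exponent `2n(ρε/36)²` equals `n ρ² ε² / 648`.
    have h1 : Real.log (2 / δ) + ((S.card : ℝ) + 1) * Real.log 2 ≤
        2 * n * (ρ * ε / 18 / 2) ^ 2 := by
      rw [div_le_iff₀ (by positivity)] at hnle
      nlinarith
    have h2 : Real.exp (-(2 * n * (ρ * ε / 18 / 2) ^ 2)) ≤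
        (δ / 2) * ((2 : ℝ) ^ (S.card + 1))⁻¹ := by
      refine (Real.exp_le_exp.mpr (neg_le_neg h1)).trans (le_of_eq ?_)
      rw [neg_add, Real.exp_add, Real.exp_neg, Real.exp_log (by positivity), inv_div]
      congr 1
      rw [Real.exp_neg, mul_comm, Real.exp_mul, Real.exp_log (by norm_num)]
      norm_cast
    calc (2 : ℝ) ^ S.card * (2 * Real.exp (-(2 * n * (ρ * ε / 18 / 2) ^ 2)))
        = 2 ^ (S.card + 1) * Real.exp (-(2 * n * (ρ * ε / 18 / 2) ^ 2)) := by rw [pow_succ]; ring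
      _ ≤ 2 ^ (S.card + 1) * ((δ / 2) * ((2 : ℝ) ^ (S.card + 1))⁻¹) := by gcongr
      _ = δ / 2 := by field_simp
  calc _ ≤ ∑ T ∈ S.powerset, 2 * ENNReal.ofReal (Real.exp (-(2 * n * (ρ * ε / 18 / 2) ^ 2))) := by
        refine (measure_mono hsub).trans ((measure_biUnion_finset_le _ _).trans ?_)
        exact Finset.sum_le_sum fun T _ => measure_empirical_dev_le Q T hnm hnpos hs
    _ = ENNReal.ofReal ((2 : ℝ) ^ S.card *
          (2 * Real.exp (-(2 * n * (ρ * ε / 18 / 2) ^ 2)))) := by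
        rw [Finset.sum_const, Finset.card_powerset, nsmul_eq_mul, ENNReal.ofReal_mul (by positivity),
          ENNReal.ofReal_mul (by positivity)]
        congr 1
        · rw [ENNReal.ofReal_pow (by positivity)]; simp
        · simp
    _ ≤ _ := ENNReal.ofReal_le_ofReal hexp

/-! ### Heavy hitters -/

/-- At most `1/(v - ε)` points are this heavy, and each is missed by all samples with probability at
most `exp(-n(v - ε)) ≤ δ(v - ε)/2`. On a small domain nothing can be missed. -/
lemma measure_missed_candidate_le [MeasurableSingletonClass α] (Q : Measure α) [IsProbabilityMeasure Q]
    (dom : Finset α) (hdom : ∀ c ∉ dom, Q.real {c} = 0) {v ε δ : ℝ} (hv : ε < v) (hδ : 0 < δ) :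
    (Measure.pi fun _ : Fin (candCount dom v ε δ) => Q)
      {x | ∃ c, v - ε ≤ Q.real {c} ∧ c ∉ candidates dom v ε δ x} ≤ ENNReal.ofReal (δ / 2) := by
  have hw : 0 < v - ε := by linarith
  have hmem : ∀ c, v - ε ≤ Q.real {c} → c ∈ dom := by
    intro c hc
    by_contra h
    rw [hdom c h] at hc
    linarith
  by_cases hsmall : (dom.card : ℝ) < candReal v ε δ
  · have : {x | ∃ c, v - ε ≤ Q.real {c} ∧ c ∉ candidates dom v ε δ x} = ∅ := by
      refine Set.eq_empty_iff_forall_notMem.mpr ?_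
      rintro x ⟨c, hc, hx⟩
      rw [candidates, if_pos hsmall] at hx
      exact hx (hmem c hc)
    rw [this]
    simp
  · set n := candCount dom v ε δ with hn
    have hnle : candReal v ε δ ≤ n := by
      rw [hn, candCount, if_neg hsmall]
      exact Nat.le_ceil _
    set Hv := dom.filter fun c => v - ε ≤ Q.real {c} with hHv
    have hcard : (Hv.card : ℝ) * (v - ε) ≤ 1 := by
      calc (Hv.card : ℝ) * (v - ε) ≤ ∑ c ∈ Hv, Q.real {c} := by
            rw [← nsmul_eq_mul]
            exact Finset.card_nsmul_le_sum _ _ _ fun c hc => (Finset.mem_filter.mp hc).2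
        _ ≤ 1 := by rw [sum_measureReal_singleton]; exact measureReal_le_one
    have hsub : {x | ∃ c, v - ε ≤ Q.real {c} ∧ c ∉ candidates dom v ε δ x} ⊆
        ⋃ c ∈ Hv, Set.univ.pi fun _ : Fin n => ({c}ᶜ : Set α) := by
      rintro x ⟨c, hc, hx⟩
      refine Set.mem_iUnion₂.mpr ⟨c, Finset.mem_filter.mpr ⟨hmem c hc, hc⟩, ?_⟩
      rw [candidates, if_neg hsmall] at hx
      intro j _ hj
      exact hx (Finset.mem_image.mpr ⟨j, Finset.mem_univ _, hj⟩)
    have hone : ∀ c ∈ Hv, (Measure.pi fun _ : Fin n => Q)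
        (Set.univ.pi fun _ : Fin n => ({c}ᶜ : Set α)) ≤ ENNReal.ofReal (δ * (v - ε) / 2) := by
      intro c hc
      have hc : v - ε ≤ Q.real {c} := (Finset.mem_filter.mp hc).2
      rw [Measure.pi_pi, Finset.prod_const, Finset.card_univ, Fintype.card_fin,
        ← ENNReal.ofReal_toReal (measure_ne_top Q _), ← ENNReal.ofReal_pow ENNReal.toReal_nonneg]
      refine ENNReal.ofReal_le_ofReal ?_
      change Q.real {c}ᶜ ^ n ≤ _
      rw [probReal_compl_eq_one_sub (measurableSet_singleton c)]
      have h1 : 1 - Q.real {c} ≤ Real.exp (-(v - ε)) := by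
        have := Real.add_one_le_exp (-(v - ε))
        linarith
      calc (1 - Q.real {c}) ^ n ≤ Real.exp (-(v - ε)) ^ n := by
            gcongr
            linarith [measureReal_le_one (μ := Q) (s := {c})]
        _ = Real.exp (-(n * (v - ε))) := by rw [← Real.exp_nat_mul]; congr 1; ring
        _ ≤ Real.exp (-(candReal v ε δ * (v - ε))) := by gcongr
        _ = δ * (v - ε) / 2 := by
            rw [candReal, div_mul_cancel₀ _ hw.ne', Real.exp_neg, Real.exp_log (by positivity),
              inv_div]
    calc _ ≤ ∑ c ∈ Hv, ENNReal.ofReal (δ * (v - ε) / 2) :=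
          (measure_mono hsub).trans ((measure_biUnion_finset_le _ _).trans (Finset.sum_le_sum hone))
      _ = ENNReal.ofReal (Hv.card * (δ * (v - ε) / 2)) := by
          rw [Finset.sum_const, nsmul_eq_mul, ENNReal.ofReal_mul (by positivity),
            ENNReal.ofReal_natCast]
      _ ≤ _ := by
          refine ENNReal.ofReal_le_ofReal ?_
          nlinarith

/-- The samples of a heavy hitters call are accurate for the distribution `Q`: every heavy point is
a candidate, and the empirical masses of the candidates have small total error. -/
def Accurate (Q : Measure α) (dom : Finset α) (v ε ρ δ : ℝ) (x : Fin (candCount dom v ε δ) → α)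
    (y : Fin (massCount ρ ε δ (candBound dom v ε δ)) → α) : Prop :=
  (∀ c, v - ε ≤ Q.real {c} → c ∈ candidates dom v ε δ x) ∧
    ∑ c ∈ candidates dom v ε δ x,
      |empirical (massCount ρ ε δ (candidates dom v ε δ x).card) y c - Q.real {c}| < ρ * ε / 18

/-- Each of the two phases fails with probability at most `δ/2`, the second one conditionally on the
candidates found by the first. -/
lemma measure_not_accurate_le [Countable α] [MeasurableSingletonClass α]
    (Q : Measure α) [IsProbabilityMeasure Q] (dom : Finset α)
    (hdom : ∀ c ∉ dom, Q.real {c} = 0) {v ε ρ δ : ℝ} (hε : 0 < ε) (hv : ε < v) (hρ : 0 < ρ)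
    (hδ : 0 < δ) (hδ1 : δ < 1) :
    ((Measure.pi fun _ : Fin (candCount dom v ε δ) => Q).prod
        (Measure.pi fun _ : Fin (massCount ρ ε δ (candBound dom v ε δ)) => Q))
      {w | ¬ Accurate Q dom v ε ρ δ w.1 w.2} ≤ ENNReal.ofReal δ := by
  have h1 := measure_missed_candidate_le Q dom hdom hv hδ
  have h2 := prod_le_of_forall_fiber (Measure.pi fun _ : Fin (candCount dom v ε δ) => Q)
    (Measure.pi fun _ : Fin (massCount ρ ε δ (candBound dom v ε δ)) => Q) measurable_id
    (fun x y => ρ * ε / 18 ≤ ∑ c ∈ candidates dom v ε δ x,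
      |empirical (massCount ρ ε δ (candidates dom v ε δ x).card) y c - Q.real {c}|)
    (fun x => measure_sum_abs_empirical_le Q _ hρ hε hδ hδ1
      (massCount_mono (card_candidates_le dom v ε δ x)))
  refine (measure_mono (t := ({x | ∃ c, v - ε ≤ Q.real {c} ∧ c ∉ candidates dom v ε δ x} ×ˢ
    Set.univ) ∪ _) ?_).trans (((measure_union_le _ _).trans
      (add_le_add (b := ENNReal.ofReal (δ / 2)) ?_ h2)).trans ?_)
  · intro w hw
    by_cases hc : ∃ c, v - ε ≤ Q.real {c} ∧ c ∉ candidates dom v ε δ w.1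
    · exact Or.inl ⟨hc, trivial⟩
    · refine Or.inr (not_lt.mp fun h => hw ⟨fun c h' => ?_, h⟩)
      by_contra h''
      exact hc ⟨c, h', h''⟩
  · rw [Measure.prod_prod, measure_univ, mul_one]
    exact h1
  · rw [← ENNReal.ofReal_add (by positivity) (by positivity), add_halves]

lemma Accurate.abs_sub_lt {Q : Measure α} {dom : Finset α} {v ε ρ δ : ℝ}
    {x : Fin (candCount dom v ε δ) → α} {y : Fin (massCount ρ ε δ (candBound dom v ε δ)) → α}
    (h : Accurate Q dom v ε ρ δ x y) {c : α} (hc : c ∈ candidates dom v ε δ x) :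
    |empirical (massCount ρ ε δ (candidates dom v ε δ x).card) y c - Q.real {c}| < ρ * ε / 18 :=
  (Finset.single_le_sum (f := fun c => |empirical (massCount ρ ε δ (candidates dom v ε δ x).card)
    y c - Q.real {c}|) (fun _ _ => abs_nonneg _) hc).trans_lt h.2

/-- The threshold is at least `v - 2ε/3` and the empirical error is below `ε/18`. -/
lemma Accurate.le_mass_of_mem {Q : Measure α} {dom : Finset α} {v ε ρ δ : ℝ}
    {x : Fin (candCount dom v ε δ) → α} {y : Fin (massCount ρ ε δ (candBound dom v ε δ)) → α}
    (h : Accurate Q dom v ε ρ δ x y) (hε : 0 < ε) (hρ1 : ρ ≤ 1) {u : ℝ} (hu : 0 ≤ u) {c : α}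
    (hc : c ∈ heavyHitters dom v ε ρ δ x y u) : v - ε ≤ Q.real {c} := by
  obtain ⟨hcand, hthr⟩ := Finset.mem_filter.mp hc
  have := (abs_lt.mp (h.abs_sub_lt hcand)).2
  have : ρ * ε ≤ ε := by nlinarith
  have : 0 ≤ u * (ε / 3) := by positivity
  linarith

/-- A point of mass at least `v` is a candidate, and its empirical mass exceeds `v - ε/18`, while
the threshold is at most `v - ε/3`. -/
lemma Accurate.mass_lt_of_notMem {Q : Measure α} {dom : Finset α} {v ε ρ δ : ℝ}
    {x : Fin (candCount dom v ε δ) → α} {y : Fin (massCount ρ ε δ (candBound dom v ε δ)) → α}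
    (h : Accurate Q dom v ε ρ δ x y) (hε : 0 < ε) (hρ1 : ρ ≤ 1) {u : ℝ} (hu : u ≤ 1) {c : α}
    (hc : c ∉ heavyHitters dom v ε ρ δ x y u) : Q.real {c} < v := by
  by_contra hle
  rw [not_lt] at hle
  have hcand := h.1 c (by linarith)
  refine hc (Finset.mem_filter.mpr ⟨hcand, ?_⟩)
  have := (abs_lt.mp (h.abs_sub_lt hcand)).1
  have : ρ * ε ≤ ε := by nlinarith
  have : u * (ε / 3) ≤ ε / 3 := by nlinarith
  linarith

/-- The seed must fall between the values at which some common candidate leaves the two outputs.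
These intervals have total length at most `(3/ε)(ρε/9) = ρ/3`. -/
lemma measure_heavyHitters_ne_le {Q : Measure α} {dom : Finset α} {v ε ρ δ : ℝ}
    {x x' : Fin (candCount dom v ε δ) → α}
    {y y' : Fin (massCount ρ ε δ (candBound dom v ε δ)) → α}
    (h : Accurate Q dom v ε ρ δ x y) (h' : Accurate Q dom v ε ρ δ x' y') (hε : 0 < ε)
    (hρ : 0 < ρ) (hρ1 : ρ ≤ 1) :
    ((volume : Measure ℝ).restrict (Set.Icc 0 1))
      {u | heavyHitters dom v ε ρ δ x y u ≠ heavyHitters dom v ε ρ δ x' y' u} ≤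
        ENNReal.ofReal (ρ / 3) := by
  set S := candidates dom v ε δ x with hS
  set S' := candidates dom v ε δ x' with hS'
  set e := empirical (massCount ρ ε δ S.card) y with he
  set e' := empirical (massCount ρ ε δ S'.card) y' with he'
  -- The seed for which the threshold equals `s`.
  let l : ℝ → ℝ := fun s => (s - (v - 2 / 3 * ε)) * (3 / ε)
  have hl : ∀ u s, v - 2 / 3 * ε + u * (ε / 3) ≤ s ↔ u ≤ l s := by
    intro u s
    have : l s = (s - (v - 2 / 3 * ε)) / (ε / 3) := by simp only [l]; field_simp
    rw [this, le_div_iff₀ (by positivity)]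
    constructor <;> intro <;> linarith
  have hsub : {u | heavyHitters dom v ε ρ δ x y u ≠ heavyHitters dom v ε ρ δ x' y' u} ∩
      Set.Icc 0 1 ⊆ ⋃ c ∈ S ∩ S', Set.Ioc (min (l (e c)) (l (e' c))) (max (l (e c)) (l (e' c))) := by
    rintro u ⟨hu, hu01⟩
    obtain ⟨c, hc⟩ : ∃ c, ¬ (c ∈ heavyHitters dom v ε ρ δ x y u ↔
        c ∈ heavyHitters dom v ε ρ δ x' y' u) := by
      by_contra hcon
      push Not at hcon
      exact hu (Finset.ext hcon)
    -- A point returned by either run has true mass at least `v - ε`, hence is a candidate in both.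
    have hmem : c ∈ S ∧ c ∈ S' := by
      have hm : v - ε ≤ Q.real {c} := by
        by_contra hlt
        exact hc ⟨fun hh => absurd (h.le_mass_of_mem hε hρ1 hu01.1 hh) hlt,
          fun hh => absurd (h'.le_mass_of_mem hε hρ1 hu01.1 hh) hlt⟩
      exact ⟨h.1 c hm, h'.1 c hm⟩
    refine Set.mem_iUnion₂.mpr ⟨c, Finset.mem_inter.mpr hmem, ?_⟩
    have e1 : c ∈ heavyHitters dom v ε ρ δ x y u ↔ u ≤ l (e c) := by
      rw [← hl, heavyHitters, Finset.mem_filter]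
      exact and_iff_right hmem.1
    have e2 : c ∈ heavyHitters dom v ε ρ δ x' y' u ↔ u ≤ l (e' c) := by
      rw [← hl, heavyHitters, Finset.mem_filter]
      exact and_iff_right hmem.2
    rw [e1, e2] at hc
    rw [Set.mem_Ioc, min_lt_iff, le_max_iff]
    rcases le_or_gt u (l (e c)) with h1 | h1 <;> rcases le_or_gt u (l (e' c)) with h2 | h2
    · exact absurd (iff_of_true h1 h2) hc
    · exact ⟨Or.inr h2, Or.inl h1⟩
    · exact ⟨Or.inl h1, Or.inr h2⟩
    · exact absurd (iff_of_false h1.not_ge h2.not_ge) hc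
  have hsum : ∑ c ∈ S ∩ S', |e c - e' c| ≤ ρ * ε / 9 := by
    have h1 : ∑ c ∈ S ∩ S', |e c - Q.real {c}| ≤ ∑ c ∈ S, |e c - Q.real {c}| :=
      Finset.sum_le_sum_of_subset_of_nonneg Finset.inter_subset_left fun _ _ _ => abs_nonneg _
    have h2 : ∑ c ∈ S ∩ S', |e' c - Q.real {c}| ≤ ∑ c ∈ S', |e' c - Q.real {c}| :=
      Finset.sum_le_sum_of_subset_of_nonneg Finset.inter_subset_right fun _ _ _ => abs_nonneg _
    have h3 : ∑ c ∈ S ∩ S', |e c - e' c| ≤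
        ∑ c ∈ S ∩ S', (|e c - Q.real {c}| + |e' c - Q.real {c}|) := by
      refine Finset.sum_le_sum fun c _ => ?_
      rw [abs_sub_comm (e' c)]
      exact _root_.abs_sub_le _ _ _
    rw [Finset.sum_add_distrib] at h3
    have := h.2
    have := h'.2
    linarith
  rw [Measure.restrict_apply' measurableSet_Icc]
  calc _ ≤ ∑ c ∈ S ∩ S', volume
          (Set.Ioc (min (l (e c)) (l (e' c))) (max (l (e c)) (l (e' c)))) :=
        (measure_mono hsub).trans (measure_biUnion_finset_le _ _)
    _ = ENNReal.ofReal (∑ c ∈ S ∩ S', |e c - e' c| * (3 / ε)) := by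
        rw [ENNReal.ofReal_sum_of_nonneg fun _ _ => by positivity]
        refine Finset.sum_congr rfl fun c _ => ?_
        rw [Real.volume_Ioc, max_sub_min_eq_abs']
        congr 1
        rw [← sub_mul, sub_sub_sub_cancel_right, abs_mul,
          abs_of_pos (show 0 < 3 / ε by positivity)]
    _ ≤ _ := by
        refine ENNReal.ofReal_le_ofReal ?_
        rw [← Finset.sum_mul]
        calc _ ≤ ρ * ε / 9 * (3 / ε) := by gcongr
          _ = ρ / 3 := by field_simp; norm_num

end HeavyHitters

/-! ### Trees of heavy cells -/

/-- A tree of heavy cells of depth less than `t`. -/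
structure IsCellTree (H : ℕ → Finset (Cell d)) (t : ℕ) : Prop where
  zero : H 0 = grid d 0
  succ_subset : ∀ i, H (i + 1) ⊆ children i (H i)
  eq_empty : ∀ i, t ≤ i → H i = ∅

lemma mem_children {i : ℕ} {s : Finset (Cell d)} {c : Cell d} :
    c ∈ children i s ↔ c ∈ grid d (i + 1) ∧ parent c ∈ s := Finset.mem_filter

lemma cellOf_mem_children {i : ℕ} {s : Finset (Cell d)} {y : Fin d → ℝ} (h : cellOf i y ∈ s) :
    cellOf (i + 1) y ∈ children i s :=
  mem_children.mpr ⟨cellOf_mem_grid _ _, by rwa [parent_cellOf]⟩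

namespace IsCellTree

variable {H : ℕ → Finset (Cell d)} {t : ℕ}

lemma subset_grid (hH : IsCellTree H t) : ∀ i, H i ⊆ grid d i
  | 0 => hH.zero.subset
  | i + 1 => (hH.succ_subset i).trans (Finset.filter_subset _ _)

lemma mem_of_le (hH : IsCellTree H t) {y : Fin d → ℝ} {i j : ℕ} (hij : i ≤ j)
    (h : cellOf j y ∈ H j) : cellOf i y ∈ H i := by
  induction j, hij using Nat.le_induction with
  | base => exact h
  | succ j _ ih =>
    refine ih ?_
    have := (mem_children.mp (hH.succ_subset j h)).2
    rwa [parent_cellOf] at this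

lemma lt_of_mem (hH : IsCellTree H t) {i : ℕ} {c : Cell d} (h : c ∈ H i) : i < t := by
  by_contra hi
  rw [hH.eq_empty i (not_lt.mp hi)] at h
  simp at h

end IsCellTree

/-- The leaves of a tree of cells, as pairs of a level and a cell. -/
def leaves (H : ℕ → Finset (Cell d)) (t : ℕ) : Finset (Σ _ : ℕ, Cell d) :=
  (Finset.range t).sigma fun j => (H j).filter fun c => ¬ (children j {c} ∩ H (j + 1)).Nonempty

lemma mem_leaves {H : ℕ → Finset (Cell d)} {t : ℕ} {l : Σ _ : ℕ, Cell d} :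
    l ∈ leaves H t ↔ l.1 < t ∧ l.2 ∈ H l.1 ∧ ¬ (children l.1 {l.2} ∩ H (l.1 + 1)).Nonempty := by
  simp [leaves]

/-- The cells containing a point form a chain, and the tree is closed under ancestors: the shallower
of two leaves on it would have a child in the tree. -/
lemma IsCellTree.leaf_unique {H : ℕ → Finset (Cell d)} {t : ℕ} (hH : IsCellTree H t)
    {l l' : Σ _ : ℕ, Cell d} (hl : l ∈ leaves H t) (hl' : l' ∈ leaves H t) {y : Fin d → ℝ}
    (hy : cellOf l.1 y = l.2) (hy' : cellOf l'.1 y = l'.2) : l = l' := by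
  have key : ∀ {l l' : Σ _ : ℕ, Cell d}, l ∈ leaves H t → l' ∈ leaves H t →
      cellOf l.1 y = l.2 → cellOf l'.1 y = l'.2 → ¬ l.1 < l'.1 := by
    intro l l' hl hl' hy hy' hlt
    refine (mem_leaves.mp hl).2.2 ⟨cellOf (l.1 + 1) y, Finset.mem_inter.mpr ⟨?_, ?_⟩⟩
    · exact cellOf_mem_children (by simp [hy])
    · exact hH.mem_of_le hlt (by rw [hy']; exact (mem_leaves.mp hl').2.1)
  have h1 : l.1 = l'.1 := le_antisymm (not_lt.mp (key hl' hl hy' hy)) (not_lt.mp (key hl hl' hy hy'))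
  obtain ⟨j, c⟩ := l
  obtain ⟨j', c'⟩ := l'
  simp only at h1 hy hy'
  subst h1
  rw [← hy, ← hy']

/-- The bound `t ≤ j + n` ensures that the descent reaches a leaf before its step counter runs out.
The last alternative isolates the root, the only cell of the tree that no heavy hitters call has
returned. -/
lemma IsCellTree.cellRep_spec {D : Set (Fin d → ℝ)} (ch : ChoiceRule d D)
    {H : ℕ → Finset (Cell d)} {t : ℕ} (hH : IsCellTree H t) :
    ∀ (n j : ℕ) (Z : Cell d), Z ∈ H j → t ≤ j + n →
      ∃ l ∈ leaves H t, cellRep ch H n j Z = ch.pt l.1 l.2 ∧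
        (∀ z, cellOf l.1 z = l.2 → cellOf j z = Z) ∧ (l = ⟨j, Z⟩ ∨ 1 ≤ l.1)
  | 0, j, Z, hZ, hj => absurd (hH.lt_of_mem hZ) (by omega)
  | n + 1, j, Z, hZ, hj => by
    rw [cellRep]
    split_ifs with h
    · have hc := Finset.mem_inter.mp (ch.child_mem (j + 1) _ h)
      obtain ⟨l, hl, hrep, hanc, hpos⟩ := hH.cellRep_spec ch n (j + 1) _ hc.2 (by omega)
      refine ⟨l, hl, hrep, fun z hz => ?_, Or.inr ?_⟩
      · rw [← parent_cellOf, hanc z hz]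
        exact Finset.mem_singleton.mp (mem_children.mp hc.1).2
      · rcases hpos with rfl | hpos
        · simp
        · exact hpos
    · exact ⟨⟨j, Z⟩, mem_leaves.mpr ⟨hH.lt_of_mem hZ, hZ, h⟩, rfl, fun z hz => hz, Or.inl rfl⟩

/-- The map that sends a point to the representative of the deepest cell of the tree that
contains it. -/
noncomputable def repMap {D : Set (Fin d → ℝ)} (ch : ChoiceRule d D) (H : ℕ → Finset (Cell d))
    (t : ℕ) (y : Fin d → ℝ) : Fin d → ℝ :=
  cellRep ch H t (Nat.findGreatest (fun j => cellOf j y ∈ H j) t)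
    (cellOf (Nat.findGreatest (fun j => cellOf j y ∈ H j) t) y)

section RepMap

variable {D : Set (Fin d → ℝ)} (ch : ChoiceRule d D) {H : ℕ → Finset (Cell d)} {t : ℕ}

lemma IsCellTree.repMap_spec (hH : IsCellTree H t) (y : Fin d → ℝ) :
    ∃ j, cellOf j y ∈ H j ∧ cellOf (j + 1) y ∉ H (j + 1) ∧
      ∃ l ∈ leaves H t, repMap ch H t y = ch.pt l.1 l.2 ∧
        (∀ z, cellOf l.1 z = l.2 → cellOf j z = cellOf j y) ∧ (cellOf l.1 y = l.2 ∨ 1 ≤ l.1) := by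
  set j := Nat.findGreatest (fun j => cellOf j y ∈ H j) t with hj
  have hmem : cellOf j y ∈ H j := by
    refine Nat.findGreatest_spec (P := fun j => cellOf j y ∈ H j) (Nat.zero_le t) ?_
    rw [hH.zero]
    exact cellOf_mem_grid 0 y
  refine ⟨j, hmem, fun h => ?_, ?_⟩
  · exact Nat.findGreatest_is_greatest (P := fun j => cellOf j y ∈ H j) (Nat.lt_succ_self j)
      (hH.lt_of_mem h).le h
  · obtain ⟨l, hl, hrep, hanc, hpos⟩ := hH.cellRep_spec ch t j _ hmem (by omega)
    refine ⟨l, hl, hrep, hanc, ?_⟩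
    rcases hpos with rfl | hpos
    · exact Or.inl rfl
    · exact Or.inr hpos

/-- The map factors through the deepest level and the cell at that level, a measurable pair in a
countable space. -/
lemma measurable_repMap : Measurable (repMap ch H t) := by
  have hj : Measurable fun y : Fin d → ℝ => Nat.findGreatest (fun j => cellOf j y ∈ H j) t :=
    measurable_findGreatest fun j _ => measurable_cellOf j (H j).measurableSet
  have hcell : Measurable fun p : ℕ × (Fin d → ℝ) => (p.1, cellOf p.1 p.2) :=
    measurable_from_prod_countable_right fun j => measurable_const.prodMk (measurable_cellOf j)
  have hrep : Measurable fun p : ℕ × Cell d => cellRep ch H t p.1 p.2 := measurable_of_countable _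
  exact hrep.comp (hcell.comp (hj.prodMk measurable_id))

lemma IsCellTree.dist_repMap_le (hH : IsCellTree H t) (N : SignInvariantNorm d) {y : Fin d → ℝ}
    (hy : ∀ j, y j ∈ Set.Icc (-(1 / 2) : ℝ) (1 / 2)) :
    ∃ j, cellOf j y ∈ H j ∧ cellOf (j + 1) y ∉ H (j + 1) ∧
      N.dist y (repMap ch H t y) ≤ (2 ^ j)⁻¹ * N.diam := by
  obtain ⟨j, h1, h2, l, hl, hrep, hanc, -⟩ := hH.repMap_spec ch y
  refine ⟨j, h1, h2, ?_⟩
  obtain ⟨-, hl, -⟩ := mem_leaves.mp hl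
  have hreg := ch.pt_mem_region l.1 l.2 (hH.subset_grid _ hl)
  rw [hrep]
  exact dist_le_of_cellOf_eq N hy hreg.1 (hanc _ hreg.2).symm

lemma IsCellTree.repMap_mem (hH : IsCellTree H t)
    (hD : ∀ i, 1 ≤ i → ∀ c ∈ H i, (region d i c ∩ D).Nonempty) {y : Fin d → ℝ} (hyD : y ∈ D)
    (hy : ∀ j, y j ∈ Set.Icc (-(1 / 2) : ℝ) (1 / 2)) : repMap ch H t y ∈ D := by
  obtain ⟨j, -, -, l, hl, hrep, -, hpos⟩ := hH.repMap_spec ch y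
  obtain ⟨-, hl, -⟩ := mem_leaves.mp hl
  rw [hrep]
  refine ch.pt_mem_of_nonempty _ _ (hH.subset_grid _ hl) ?_
  rcases hpos with hpos | hpos
  -- If the leaf contains `y`, as the root always does, then `y` itself witnesses that it meets `D`.
  · exact ⟨y, ⟨hy, hpos⟩, hyD⟩
  · exact hD _ hpos _ hl

lemma IsCellTree.range_repMap_subset (hH : IsCellTree H t) :
    Set.range (repMap ch H t) ⊆ (fun l : Σ _ : ℕ, Cell d => ch.pt l.1 l.2) '' (leaves H t) := by
  rintro _ ⟨y, rfl⟩
  obtain ⟨j, -, -, l, hl, hrep, -, -⟩ := hH.repMap_spec ch y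
  exact ⟨l, hl, hrep.symm⟩

lemma IsCellTree.ncard_image_le (hH : IsCellTree H t) (X : Set (Fin d → ℝ)) :
    (repMap ch H t '' X).Finite ∧ (repMap ch H t '' X).ncard ≤ (leaves H t).card := by
  have hsub := (Set.image_subset_range (repMap ch H t) X).trans (hH.range_repMap_subset ch)
  have hfin : ((fun l : Σ _ : ℕ, Cell d => ch.pt l.1 l.2) '' (leaves H t)).Finite :=
    (leaves H t).finite_toSet.image _
  refine ⟨hfin.subset hsub, (Set.ncard_le_ncard hsub hfin).trans ?_⟩
  refine (Set.ncard_image_le (leaves H t).finite_toSet).trans ?_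
  rw [Set.ncard_coe_finset]

end RepMap

/-! ### Cost of moving points to their representatives -/

lemma mem_nearCells {N : SignInvariantNorm d} {F : Finset (Fin d → ℝ)} {i : ℕ} {r : ℝ}
    {c : Cell d} : c ∈ nearCells N F i r ↔
      c ∈ grid d i ∧ ∃ x, cellOf i x = c ∧ ∃ f ∈ F, N.dist x f < r := by
  classical
  simp [nearCells]

lemma le_distTo_of_notMem_nearCells (N : SignInvariantNorm d) {F : Finset (Fin d → ℝ)}
    (hF : F.Nonempty) {i : ℕ} {r : ℝ} {y : Fin d → ℝ} (h : cellOf i y ∉ nearCells N F i r) :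
    r ≤ N.distTo y F := by
  obtain ⟨f, hf, heq⟩ := N.exists_distTo_eq y hF
  rw [heq]
  by_contra hlt
  exact h (mem_nearCells.mpr ⟨cellOf_mem_grid _ _, y, rfl, f, hf, not_le.mp hlt⟩)

/-- The probability of a cell. -/
noncomputable def cellMass (P : Measure (Fin d → ℝ)) (i : ℕ) (c : Cell d) : ℝ :=
  P.real (cellOf i ⁻¹' {c})

lemma measurableSet_cell (i : ℕ) (c : Cell d) :
    MeasurableSet (cellOf (d := d) i ⁻¹' {c}) :=
  measurable_cellOf i (measurableSet_singleton c)

lemma integral_cell (P : Measure (Fin d → ℝ)) (i : ℕ) (c : Cell d) (r : ℝ) :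
    ∫ y, (cellOf i ⁻¹' {c}).indicator (fun _ => r) y ∂P = cellMass P i c * r := by
  rw [integral_indicator_const _ (measurableSet_cell i c), smul_eq_mul, cellMass]

lemma integrable_cell (P : Measure (Fin d → ℝ)) [IsFiniteMeasure P] (i : ℕ) (c : Cell d) (r : ℝ) :
    Integrable ((cellOf i ⁻¹' {c}).indicator fun _ => r) P :=
  (integrable_const r).indicator (measurableSet_cell i c)

/-- Explains the constant in `M = (2^5 Δ/ε)^d`: near cells are taken with `L = 10Δ/ε`, and `20 + 2 ≤
32` since `Δ/ε ≥ 1`. -/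
lemma nearRadius_le {N : SignInvariantNorm d} (hd : 0 < d) {ε : ℝ} (hε : 0 < ε) (hε1 : ε < 1) :
    2 * (10 * N.diam / ε) + 2 ≤ 2 ^ 5 / ε * N.diam := by
  have h1 : 1 ≤ N.diam / ε := by
    rw [le_div_iff₀ hε]
    linarith [N.one_le_diam hd]
  have e1 : 2 * (10 * N.diam / ε) = 20 * (N.diam / ε) := by ring
  have e2 : 2 ^ 5 / ε * N.diam = 32 * (N.diam / ε) := by ring
  rw [e1, e2]
  linarith

lemma card_nearCells_le' (N : SignInvariantNorm d) (hd : 0 < d) {ε : ℝ} (hε : 0 < ε)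
    (hε1 : ε < 1) {F : Finset (Fin d → ℝ)} (hF : (F : Set (Fin d → ℝ)) ⊆ N.ball) (i : ℕ) :
    ((nearCells N F i (10 * N.diam / ε / 2 ^ i)).card : ℝ) ≤
      F.card * (2 ^ 5 / ε * N.diam) ^ d := by
  have hdiam := N.one_le_diam hd
  have hL : 0 ≤ 10 * N.diam / ε := by positivity
  refine (card_nearCells_le N hF i hL).trans ?_
  gcongr
  exact nearRadius_le hd hε hε1

/-- The normalization of `γ`: `t` levels with `kM` near cells of mass `γΛ2^i`, each moved by
`2Δ/2^i`, contribute `εΛ/5` in total. -/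
lemma gamma_mul (N : SignInvariantNorm d) (hd : 0 < d) (a : Params) (hk : 1 ≤ a.k) (ht : 1 ≤ a.t)
    (hε : 0 < a.ε) :
    gamma N a * (a.t * (a.k * (2 ^ 5 / a.ε * N.diam) ^ d)) * (2 * N.diam) = a.ε / 5 := by
  have hdiam := N.one_le_diam hd
  have hk' : (0 : ℝ) < a.k := by exact_mod_cast hk
  have ht' : (0 : ℝ) < a.t := by exact_mod_cast ht
  have hD : 0 < N.diam := by linarith
  have hM : 0 < (2 ^ 5 / a.ε * N.diam) ^ d := by positivity
  rw [gamma]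
  field_simp

lemma gamma_pos (N : SignInvariantNorm d) (hd : 0 < d) (a : Params) (hk : 1 ≤ a.k) (ht : 1 ≤ a.t)
    (hε : 0 < a.ε) : 0 < gamma N a := by
  have hdiam := N.one_le_diam hd
  have hk' : (0 : ℝ) < a.k := by exact_mod_cast hk
  have ht' : (0 : ℝ) < a.t := by exact_mod_cast ht
  have hD : 0 < N.diam := by linarith
  rw [gamma]
  positivity

section Quality

variable {D : Set (Fin d → ℝ)} (ch : ChoiceRule d D) {H : ℕ → Finset (Cell d)}

open scoped Classical in
/-- A bound for the distance of a point to its representative: the contributions of the special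
cells, of the cells far from `F`, and of the light cells near `F`. -/
noncomputable def displacementBound (N : SignInvariantNorm d) (a : Params)
    (P : Measure (Fin d → ℝ)) (F : Finset (Fin d → ℝ)) (y : Fin d → ℝ) : ℝ :=
  a.ε * a.Λ / 5 + a.ε / 5 * N.distTo y F + ∑ i ∈ testedLevels N a,
    ∑ c ∈ (nearCells N F i (10 * N.diam / a.ε / 2 ^ i)).filter fun c =>
      cellMass P i c ≤ target N a i,
      (cellOf i ⁻¹' {c}).indicator (fun _ => (2 ^ i)⁻¹ * (2 * N.diam)) y

/-- If `j` is the level of the deepest tree cell of `y`, the cell of level `j + 1` is light and near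
`F`, or far from `F`, or untested; each case is paid for by one of the three terms. -/
lemma IsCellTree.dist_repMap_le_displacementBound {N : SignInvariantNorm d} {a : Params}
    (hH : IsCellTree H a.t) {P : Measure (Fin d → ℝ)} (hd : 0 < d) (hε : 0 < a.ε) (hΛ : 0 < a.Λ)
    (hlight : ∀ i, i + 1 ∈ testedLevels N a → ∀ c ∈ children i (H i), c ∉ H (i + 1) →
      cellMass P (i + 1) c ≤ target N a (i + 1))
    {F : Finset (Fin d → ℝ)} (hF : F.Nonempty) {y : Fin d → ℝ}
    (hy : ∀ j, y j ∈ Set.Icc (-(1 / 2) : ℝ) (1 / 2)) :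
    N.dist y (repMap ch H a.t y) ≤ displacementBound N a P F y := by
  classical
  have hdiam := N.one_le_diam hd
  have hD0 : 0 < N.diam := by linarith
  obtain ⟨j, h1, h2, hdist⟩ := hH.dist_repMap_le ch N hy
  have hjt := hH.lt_of_mem h1
  have hdisp := N.distTo_nonneg y F
  have hterm : ∀ i, ∀ c, 0 ≤ (cellOf i ⁻¹' {c}).indicator
      (fun _ => (2 ^ i : ℝ)⁻¹ * (2 * N.diam)) y := by
    intro i c
    exact Set.indicator_nonneg (fun _ _ => by positivity) _
  have hsum : 0 ≤ ∑ i ∈ testedLevels N a,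
    ∑ c ∈ (nearCells N F i (10 * N.diam / a.ε / 2 ^ i)).filter (fun c =>
      cellMass P i c ≤ target N a i),
      (cellOf i ⁻¹' {c}).indicator (fun _ => (2 ^ i)⁻¹ * (2 * N.diam)) y :=
    Finset.sum_nonneg fun i _ => Finset.sum_nonneg fun c _ => hterm i c
  have h2j : (2 ^ (j + 1) : ℝ)⁻¹ * (2 * N.diam) = (2 ^ j)⁻¹ * N.diam := by
    rw [pow_succ]
    field_simp
  have hA : 0 ≤ a.ε * a.Λ / 5 := by positivity
  have hB : 0 ≤ a.ε / 5 * N.distTo y F := by positivity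
  refine hdist.trans ?_
  unfold displacementBound
  by_cases htest : j + 1 ∈ testedLevels N a
  · by_cases hnear : cellOf (j + 1) y ∈ nearCells N F (j + 1) (10 * N.diam / a.ε / 2 ^ (j + 1))
    · have hmass := hlight j htest _ (cellOf_mem_children h1) h2
      have hle := Finset.single_le_sum (f := fun i =>
        ∑ c ∈ (nearCells N F i (10 * N.diam / a.ε / 2 ^ i)).filter (fun c =>
          cellMass P i c ≤ target N a i),
          (cellOf i ⁻¹' {c}).indicator (fun _ => (2 ^ i)⁻¹ * (2 * N.diam)) y)
        (fun i _ => Finset.sum_nonneg fun c _ => hterm i c) htest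
      have hle' := Finset.single_le_sum (f := fun c => (cellOf (j + 1) ⁻¹' {c}).indicator
        (fun _ => (2 ^ (j + 1) : ℝ)⁻¹ * (2 * N.diam)) y) (fun c _ => hterm (j + 1) c)
        (s := (nearCells N F (j + 1) (10 * N.diam / a.ε / 2 ^ (j + 1))).filter fun c =>
          cellMass P (j + 1) c ≤ target N a (j + 1)) (Finset.mem_filter.mpr ⟨hnear, hmass⟩)
      have hval : (cellOf (j + 1) ⁻¹' {cellOf (j + 1) y}).indicator
        (fun _ => (2 ^ (j + 1) : ℝ)⁻¹ * (2 * N.diam)) y = (2 ^ j)⁻¹ * N.diam := by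
        rw [Set.indicator_of_mem (by simp), h2j]
      linarith
    · have hfar := le_distTo_of_notMem_nearCells N hF hnear
      -- The near radius `10Δ/(ε 2^(j+1))` is chosen so that `ε/5` of it is exactly the largest
      -- displacement `Δ/2^j`.
      have : (2 ^ j)⁻¹ * N.diam ≤ a.ε / 5 * N.distTo y F := by
        calc (2 ^ j)⁻¹ * N.diam = a.ε / 5 * (10 * N.diam / a.ε / 2 ^ (j + 1)) := by
              rw [← h2j]; field_simp; norm_num
          _ ≤ _ := by gcongr
      linarith
  -- As `j + 1 ≤ t`, an untested level must violate the condition on the cell size.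
  · have hsp : (2 : ℝ) ^ (1 - ((j + 1 : ℕ) : ℤ)) * N.diam ≤ a.ε * a.Λ / 5 := by
      by_contra hlt
      exact htest (Finset.mem_filter.mpr ⟨Finset.mem_Icc.mpr ⟨by omega, hjt⟩, not_le.mp hlt⟩)
    have e : (2 : ℝ) ^ (1 - ((j + 1 : ℕ) : ℤ)) = (2 ^ j)⁻¹ := by
      rw [← zpow_natCast, ← zpow_neg]
      congr 1
      push_cast
      ring
    rw [e] at hsp
    linarith

lemma card_testedLevels_le (N : SignInvariantNorm d) (a : Params) :
    (testedLevels N a).card ≤ a.t :=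
  (Finset.card_filter_le _ _).trans (by simp)

lemma integrable_displacementBound (N : SignInvariantNorm d) (a : Params)
    {P : Measure (Fin d → ℝ)} [IsProbabilityMeasure P] {F : Finset (Fin d → ℝ)}
    (hPF : Integrable (fun x => N.distTo x F) P) :
    Integrable (displacementBound N a P F) P := by
  unfold displacementBound
  refine ((integrable_const _).add (hPF.const_mul _)).add ?_
  exact integrable_finsetSum _ fun i _ => integrable_finsetSum _ fun c _ => integrable_cell P i c _

/-- The factor `2^i` in the target mass cancels the cell size, so every level contributes the same
bound. -/
lemma integral_displacementBound_le (N : SignInvariantNorm d) (hd : 0 < d) (a : Params)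
    (hk : 1 ≤ a.k) (ht : 1 ≤ a.t) (hε : 0 < a.ε) (hε1 : a.ε < 1) (hΛ : 0 < a.Λ)
    {P : Measure (Fin d → ℝ)} [IsProbabilityMeasure P] {F : Finset (Fin d → ℝ)}
    (hPF : Integrable (fun x => N.distTo x F) P)
    (hFB : (F : Set (Fin d → ℝ)) ⊆ N.ball) (hF : F.card = a.k)
    (hcost : a.Λ ≤ (1 + a.ε) * cost N P F) :
    ∫ y, displacementBound N a P F y ∂P ≤ a.ε * cost N P F := by
  classical
  have hdiam := N.one_le_diam hd
  have hD0 : 0 < N.diam := by linarith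
  have hγ := gamma_pos N hd a hk ht hε
  have hsumint : ∀ i, Integrable (fun y => ∑ c ∈ (nearCells N F i (10 * N.diam / a.ε / 2 ^ i)).filter
      (fun c => cellMass P i c ≤ target N a i),
      (cellOf i ⁻¹' {c}).indicator (fun _ => (2 ^ i : ℝ)⁻¹ * (2 * N.diam)) y) P :=
    fun i => integrable_finsetSum _ fun c _ => integrable_cell P i c _
  have hfirst : Integrable (fun y => a.ε * a.Λ / 5 + a.ε / 5 * N.distTo y F) P :=
    (integrable_const _).add (hPF.const_mul _)
  unfold displacementBound
  rw [integral_add hfirst (integrable_finsetSum _ fun i _ => hsumint i),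
    integral_add (integrable_const _) (hPF.const_mul _), integral_const_mul,
    integral_finsetSum _ fun i _ => hsumint i]
  have hlevel : ∀ i ∈ testedLevels N a,
      ∫ y, ∑ c ∈ (nearCells N F i (10 * N.diam / a.ε / 2 ^ i)).filter
        (fun c => cellMass P i c ≤ target N a i),
        (cellOf i ⁻¹' {c}).indicator (fun _ => (2 ^ i : ℝ)⁻¹ * (2 * N.diam)) y ∂P ≤
      gamma N a * a.Λ * (a.k * (2 ^ 5 / a.ε * N.diam) ^ d) * (2 * N.diam) := by
    intro i _
    rw [integral_finsetSum _ fun c _ => integrable_cell P i c _]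
    have hc : ∀ c ∈ (nearCells N F i (10 * N.diam / a.ε / 2 ^ i)).filter
        (fun c => cellMass P i c ≤ target N a i),
        ∫ y, (cellOf i ⁻¹' {c}).indicator (fun _ => (2 ^ i : ℝ)⁻¹ * (2 * N.diam)) y ∂P ≤
        gamma N a * a.Λ * (2 * N.diam) := by
      intro c hc
      rw [integral_cell]
      calc cellMass P i c * ((2 ^ i : ℝ)⁻¹ * (2 * N.diam))
          ≤ target N a i * ((2 ^ i : ℝ)⁻¹ * (2 * N.diam)) := by
            gcongr
            exact (Finset.mem_filter.mp hc).2
        _ = _ := by rw [target]; field_simp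
    have hcard : (((nearCells N F i (10 * N.diam / a.ε / 2 ^ i)).filter
        (fun c => cellMass P i c ≤ target N a i)).card : ℝ) ≤
        a.k * (2 ^ 5 / a.ε * N.diam) ^ d := by
      rw [← hF]
      exact (Nat.cast_le.mpr (Finset.card_filter_le _ _)).trans (card_nearCells_le' N hd hε hε1 hFB i)
    calc _ ≤ _ := Finset.sum_le_card_nsmul _ _ _ hc
      _ = (((nearCells N F i (10 * N.diam / a.ε / 2 ^ i)).filter
        (fun c => cellMass P i c ≤ target N a i)).card : ℝ) * (gamma N a * a.Λ * (2 * N.diam)) :=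
          nsmul_eq_mul _ _
      _ ≤ (a.k * (2 ^ 5 / a.ε * N.diam) ^ d) * (gamma N a * a.Λ * (2 * N.diam)) := by gcongr
      _ = _ := by ring
  have htot := Finset.sum_le_card_nsmul _ _ _ hlevel
  have htested : ((testedLevels N a).card : ℝ) ≤ a.t := by exact_mod_cast card_testedLevels_le N a
  rw [nsmul_eq_mul] at htot
  have hM : 0 ≤ gamma N a * a.Λ * (a.k * (2 ^ 5 / a.ε * N.diam) ^ d) * (2 * N.diam) := by positivity
  have htot' := htot.trans (mul_le_mul_of_nonneg_right htested hM)
  have e : (a.t : ℝ) * (gamma N a * a.Λ * (a.k * (2 ^ 5 / a.ε * N.diam) ^ d) * (2 * N.diam)) =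
      a.ε / 5 * a.Λ := by
    rw [← gamma_mul N hd a hk ht hε]
    ring
  rw [e] at htot'
  have hc0 := cost_nonneg N P F
  have hcdef : ∫ y, N.distTo y F ∂P = cost N P F := rfl
  rw [hcdef]
  simp only [integral_const, probReal_univ, one_smul]
  -- From `Λ ≤ (1 + ε) cost ≤ 2 cost`, the three terms sum to at most `(2/5 + 1/5 + 2/5) ε cost`.
  have : a.ε * a.Λ ≤ a.ε * (2 * cost N P F) := by
    refine mul_le_mul_of_nonneg_left (hcost.trans ?_) hε.le
    gcongr
    linarith
  nlinarith

lemma IsCellTree.isCoreset_repMap {N : SignInvariantNorm d} {a : Params}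
    (hH : IsCellTree H a.t) (hd : 0 < d) (hk : 1 ≤ a.k) (ht : 1 ≤ a.t) (hε : 0 < a.ε)
    (hε1 : a.ε < 1) (hΛ : 0 < a.Λ) {X : Set (Fin d → ℝ)} (hXB : X ⊆ N.ball) (hXD : X ⊆ D)
    {P : Measure (Fin d → ℝ)} [IsProbabilityMeasure P] (hPX : ∀ᵐ x ∂P, x ∈ X)
    (hΛ' : a.Λ ≤ (1 + a.ε) * opt N P a.k)
    (hlight : ∀ i, i + 1 ∈ testedLevels N a → ∀ c ∈ children i (H i), c ∉ H (i + 1) →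
      cellMass P (i + 1) c ≤ target N a (i + 1))
    (hD : ∀ i, 1 ≤ i → ∀ c ∈ H i, (region d i c ∩ D).Nonempty) :
    IsCoreset N D a.k a.ε P (P.map (repMap ch H a.t)) (repMap ch H a.t '' X) := by
  have hm := measurable_repMap ch (H := H) (t := a.t)
  have hPB : ∀ᵐ x ∂P, x ∈ N.ball := hPX.mono fun x hx => hXB hx
  have hfin := (hH.ncard_image_le ch X).1
  refine ⟨Measure.isProbabilityMeasure_map hm.aemeasurable, ?_, ?_, ?_⟩
  · rintro _ ⟨y, hy, rfl⟩
    exact hH.repMap_mem ch hD (hXD hy) (fun j => N.ball_subset_cube (hXB hy) j)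
  · refine (ae_map_iff (p := fun y => y ∈ repMap ch H a.t '' X) hm.aemeasurable
      hfin.measurableSet).mpr ?_
    exact hPX.mono fun x hx => Set.mem_image_of_mem _ hx
  · intro F hFB hF
    have hFne : F.Nonempty := Finset.card_pos.mp (by omega)
    have hint := integrable_distTo N hPB hFne hFB
    have hdiam := N.one_le_diam hd
    have hbound : ∀ᵐ y ∂P, |N.distTo (repMap ch H a.t y) F - N.distTo y F| ≤
        displacementBound N a P F y := by
      filter_upwards [hPB] with y hy
      have h := hH.dist_repMap_le_displacementBound ch hd hε hΛ hlight hFne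
        (fun j => N.ball_subset_cube hy j)
      have h1 := N.distTo_le_add (repMap ch H a.t y) y hFne
      have h2 := N.distTo_le_add y (repMap ch H a.t y) hFne
      rw [N.dist_comm (repMap ch H a.t y) y] at h1
      exact abs_le.mpr ⟨by linarith, by linarith⟩
    have hmeas : Measurable fun y => N.distTo (repMap ch H a.t y) F :=
      (N.continuous_distTo hFne).measurable.comp hm
    have hBint := integrable_displacementBound N a hint
    have hdiff : Integrable (fun y => N.distTo (repMap ch H a.t y) F - N.distTo y F) P :=
      hBint.mono' (hmeas.aestronglyMeasurable.sub hint.aestronglyMeasurable) hbound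
    have hint' : Integrable (fun y => N.distTo (repMap ch H a.t y) F) P := by
      refine (hdiff.add hint).congr (Filter.Eventually.of_forall fun y => ?_)
      simp
    have hcost' : cost N (P.map (repMap ch H a.t)) F =
        ∫ y, N.distTo (repMap ch H a.t y) F ∂P :=
      integral_map hm.aemeasurable (N.continuous_distTo hFne).aestronglyMeasurable
    have habs : |cost N (P.map (repMap ch H a.t)) F - cost N P F| ≤ a.ε * cost N P F := by
      rw [hcost', cost, ← integral_sub hint' hint]
      refine (norm_integral_le_of_norm_le (f := fun y => N.distTo (repMap ch H a.t y) F -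
        N.distTo y F) hBint hbound).trans ?_
      refine integral_displacementBound_le N hd a hk ht hε hε1 hΛ hint hFB hF (hΛ'.trans ?_)
      have := opt_le_cost N P hFB hF
      gcongr
    obtain ⟨h1, h2⟩ := abs_le.mp habs
    constructor <;> linarith

end Quality

/-! ### Number of representatives -/

/-- Leaves are disjoint; one of level `i` has mass at least `s 2^i` at distance at least `L/2^i`
from `F`, so it contributes `sL` to the cost whatever its level. -/
lemma IsCellTree.card_farLeaves_le {H : ℕ → Finset (Cell d)} {N : SignInvariantNorm d}
    {t : ℕ} (hH : IsCellTree H t) {P : Measure (Fin d → ℝ)} [IsProbabilityMeasure P]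
    {F : Finset (Fin d → ℝ)} (hF : F.Nonempty) (hPF : Integrable (fun x => N.distTo x F) P)
    {L s : ℝ} (hL : 0 ≤ L) {S : Finset (Σ _ : ℕ, Cell d)} (hS : S ⊆ leaves H t)
    (hmass : ∀ l ∈ S, s * 2 ^ l.1 ≤ cellMass P l.1 l.2)
    (hfar : ∀ l ∈ S, l.2 ∉ nearCells N F l.1 (L / 2 ^ l.1)) :
    S.card * (s * L) ≤ cost N P F := by
  have hpt : ∀ y, ∑ l ∈ S, (cellOf l.1 ⁻¹' {l.2}).indicator (fun _ => L / 2 ^ l.1) y ≤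
      N.distTo y F := by
    intro y
    by_cases hex : ∃ l ∈ S, cellOf l.1 y = l.2
    · obtain ⟨l, hl, hy⟩ := hex
      rw [Finset.sum_eq_single_of_mem l hl fun l' hl' hne => ?_]
      · rw [Set.indicator_of_mem (show y ∈ cellOf l.1 ⁻¹' {l.2} from hy)]
        refine le_distTo_of_notMem_nearCells N hF (i := l.1) ?_
        rw [hy]
        exact hfar l hl
      · refine Set.indicator_of_notMem (fun hy' => hne ?_) _
        exact hH.leaf_unique (hS hl') (hS hl) hy' hy
    · have hzero : ∀ l ∈ S, (cellOf l.1 ⁻¹' {l.2}).indicator (fun _ => L / 2 ^ l.1) y = 0 :=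
        fun l hl => Set.indicator_of_notMem (s := cellOf l.1 ⁻¹' {l.2}) (a := y)
          (fun hy => hex ⟨l, hl, hy⟩) _
      rw [Finset.sum_eq_zero hzero]
      exact N.distTo_nonneg y F
  have hint : ∑ l ∈ S, cellMass P l.1 l.2 * (L / 2 ^ l.1) ≤ cost N P F := by
    have := integral_mono (integrable_finsetSum S fun l _ => integrable_cell P l.1 l.2 (L / 2 ^ l.1))
      hPF hpt
    rw [integral_finsetSum S fun l _ => integrable_cell P l.1 l.2 (L / 2 ^ l.1)] at this
    simp only [integral_cell] at this
    exact this
  refine le_trans ?_ hint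
  rw [← nsmul_eq_mul]
  refine Finset.card_nsmul_le_sum _ _ _ fun l hl => ?_
  calc s * L = s * 2 ^ l.1 * (L / 2 ^ l.1) := by field_simp
    _ ≤ _ := by
      gcongr
      exact hmass l hl

/-- Measured against a center set of cost below `2 OPT`: at most one root leaf, `K = tkM` near
leaves and `8βK` far leaves. -/
lemma IsCellTree.card_leaves_le {H : ℕ → Finset (Cell d)} {N : SignInvariantNorm d}
    {a : Params} (hH : IsCellTree H a.t) (hd : 0 < d) (hk : 1 ≤ a.k) (ht : 1 ≤ a.t) (hε : 0 < a.ε)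
    (hε1 : a.ε < 1) {P : Measure (Fin d → ℝ)} [IsProbabilityMeasure P]
    (hPB : ∀ᵐ x ∂P, x ∈ N.ball) (hopt : 0 < opt N P a.k) {β : ℝ} (hβ : 1 ≤ β)
    (hΛ : opt N P a.k / (2 * β) ≤ a.Λ)
    (hheavy : ∀ i, 1 ≤ i → ∀ c ∈ H i, target N a i / 2 ≤ cellMass P i c) :
    ((leaves H a.t).card : ℝ) ≤ 10 * β * (a.t * (a.k * (2 ^ 5 / a.ε * N.diam) ^ d)) := by
  classical
  have hdiam := N.one_le_diam hd
  have hD0 : 0 < N.diam := by linarith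
  have hβ0 : 0 < β := by linarith
  have hk' : (1 : ℝ) ≤ a.k := by exact_mod_cast hk
  have ht' : (1 : ℝ) ≤ a.t := by exact_mod_cast ht
  have hΛ0 : 0 < a.Λ := lt_of_lt_of_le (by positivity) hΛ
  have hγ := gamma_pos N hd a hk ht hε
  obtain ⟨F, hFB, hF, hcost⟩ := exists_cost_lt N P hopt
  have hFne : F.Nonempty := Finset.card_pos.mp (by omega)
  set L := 10 * N.diam / a.ε with hL
  have hL0 : 0 < L := by positivity
  set K := (a.t : ℝ) * (a.k * (2 ^ 5 / a.ε * N.diam) ^ d) with hK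
  have hM1 : 1 ≤ (2 ^ 5 / a.ε * N.diam) ^ d := by
    apply one_le_pow₀
    have := nearRadius_le (N := N) hd hε hε1
    have : 0 ≤ 10 * N.diam / a.ε := hL0.le
    linarith
  have hK1 : 1 ≤ K := one_le_mul_of_one_le_of_one_le ht'
    (one_le_mul_of_one_le_of_one_le hk' hM1)
  let S0 := (leaves H a.t).filter fun l => l.1 = 0
  let S1 := (leaves H a.t).filter fun l => 1 ≤ l.1 ∧ l.2 ∈ nearCells N F l.1 (L / 2 ^ l.1)
  let S2 := (leaves H a.t).filter fun l => 1 ≤ l.1 ∧ l.2 ∉ nearCells N F l.1 (L / 2 ^ l.1)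
  have hcover : leaves H a.t ⊆ S0 ∪ S1 ∪ S2 := by
    intro l hl
    simp only [S0, S1, S2, Finset.mem_union, Finset.mem_filter]
    rcases Nat.eq_zero_or_pos l.1 with h | h
    · exact Or.inl (Or.inl ⟨hl, h⟩)
    · by_cases h' : l.2 ∈ nearCells N F l.1 (L / 2 ^ l.1)
      · exact Or.inl (Or.inr ⟨hl, h, h'⟩)
      · exact Or.inr ⟨hl, h, h'⟩
  have h0 : (S0.card : ℝ) ≤ 1 := by
    have : S0.card ≤ 1 := by
      refine Finset.card_le_one.mpr fun l hl l' hl' => ?_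
      obtain ⟨hl, hl0⟩ := Finset.mem_filter.mp hl
      obtain ⟨hl', hl0'⟩ := Finset.mem_filter.mp hl'
      obtain ⟨j, c⟩ := l
      obtain ⟨j', c'⟩ := l'
      simp only at hl0 hl0'
      subst hl0 hl0'
      have h1 := (mem_leaves.mp hl).2.1
      have h2 := (mem_leaves.mp hl').2.1
      rw [hH.zero, grid, Fintype.mem_piFinset] at h1 h2
      congr 1
      funext l
      have h1 := h1 l
      have h2 := h2 l
      simp at h1 h2
      omega
    exact_mod_cast this
  have h1 : (S1.card : ℝ) ≤ K := by
    have hsub : S1 ⊆ (Finset.range a.t).sigma fun i => nearCells N F i (L / 2 ^ i) := by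
      intro l hl
      obtain ⟨hl, -, hnear⟩ := Finset.mem_filter.mp hl
      exact Finset.mem_sigma.mpr ⟨Finset.mem_range.mpr (mem_leaves.mp hl).1, hnear⟩
    calc (S1.card : ℝ) ≤ (((Finset.range a.t).sigma fun i => nearCells N F i (L / 2 ^ i)).card : ℝ) := by
          exact_mod_cast Finset.card_le_card hsub
      _ = ∑ i ∈ Finset.range a.t, ((nearCells N F i (L / 2 ^ i)).card : ℝ) := by
          rw [Finset.card_sigma]; push_cast; rfl
      _ ≤ ∑ _i ∈ Finset.range a.t, (a.k : ℝ) * (2 ^ 5 / a.ε * N.diam) ^ d := by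
          refine Finset.sum_le_sum fun i _ => ?_
          rw [← hF]
          exact card_nearCells_le' N hd hε hε1 hFB i
      _ = K := by simp [hK]
  have h2 : (S2.card : ℝ) ≤ 8 * β * K := by
    have h := hH.card_farLeaves_le hFne (integrable_distTo N hPB hFne hFB) hL0.le (S := S2)
      (s := gamma N a * a.Λ / 2) (Finset.filter_subset _ _)
      (fun l hl => by
        obtain ⟨hl, hpos, -⟩ := Finset.mem_filter.mp hl
        refine le_of_eq_of_le ?_ (hheavy l.1 hpos l.2 (mem_leaves.mp hl).2.1)
        rw [target]; ring)
      (fun l hl => (Finset.mem_filter.mp hl).2.2)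
    have hgam := gamma_mul N hd a hk ht hε
    rw [← hK] at hgam
    have e : gamma N a * a.Λ / 2 * L * (2 * K) = a.Λ := by
      calc gamma N a * a.Λ / 2 * L * (2 * K)
          = (gamma N a * K * (2 * N.diam)) * (5 / a.ε) * a.Λ := by rw [hL]; ring
        _ = a.Λ := by rw [hgam]; field_simp
    have h' : (S2.card : ℝ) * a.Λ ≤ 2 * opt N P a.k * (2 * K) := by
      calc (S2.card : ℝ) * a.Λ = S2.card * (gamma N a * a.Λ / 2 * L) * (2 * K) := by
            rw [mul_assoc, e]
        _ ≤ 2 * opt N P a.k * (2 * K) :=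
            mul_le_mul_of_nonneg_right (h.trans hcost.le) (by positivity)
    have hopt' : opt N P a.k ≤ a.Λ * (2 * β) := by rwa [div_le_iff₀ (by positivity)] at hΛ
    have h'' : (S2.card : ℝ) * a.Λ ≤ (8 * β * K) * a.Λ := by
      calc (S2.card : ℝ) * a.Λ ≤ 2 * (a.Λ * (2 * β)) * (2 * K) := h'.trans (by gcongr)
        _ = _ := by ring
    exact le_of_mul_le_mul_right h'' hΛ0
  have hcard : ((leaves H a.t).card : ℝ) ≤ S0.card + S1.card + S2.card := by
    have := (Finset.card_le_card hcover).trans ((Finset.card_union_le _ _).trans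
      (Nat.add_le_add_right (Finset.card_union_le _ _) _))
    exact_mod_cast this
  have : K ≤ β * K := le_mul_of_one_le_left (by positivity) hβ
  linarith

/-! ### Heavy hitters at the levels of the grid -/

lemma target_pos {N : SignInvariantNorm d} {a : Params} (hγ : 0 < gamma N a) (hΛ : 0 < a.Λ)
    (i : ℕ) : 0 < target N a i := by
  unfold target
  positivity

lemma mem_Icc_of_mem_testedLevels {N : SignInvariantNorm d} {a : Params} {i : ℕ}
    (hi : i ∈ testedLevels N a) : 1 ≤ i ∧ i ≤ a.t :=
  Finset.mem_Icc.mp (Finset.mem_filter.mp hi).1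

lemma isProbabilityMeasure_uniform :
    IsProbabilityMeasure ((volume : Measure ℝ).restrict (Set.Icc 0 1)) :=
  ⟨by simp⟩

lemma isProbabilityMeasure_seedLaw (N : SignInvariantNorm d) (a : Params) :
    IsProbabilityMeasure (seedLaw N a) := by
  have := isProbabilityMeasure_uniform
  unfold seedLaw
  infer_instance

/-- Only an inequality is stated, so that `T` need not be measurable. -/
lemma seedLaw_eval_le (N : SignInvariantNorm d) (a : Params) (i : testedLevels N a) (T : Set ℝ) :
    seedLaw N a {u | u i ∈ T} ≤ ((volume : Measure ℝ).restrict (Set.Icc 0 1)) T := by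
  have := isProbabilityMeasure_uniform
  have h := (measurePreserving_eval
    (fun _ : testedLevels N a => (volume : Measure ℝ).restrict (Set.Icc 0 1)) i)
  conv_rhs => rw [← h.map_eq]
  exact Measure.le_map_apply h.measurable.aemeasurable T

lemma ae_seedLaw_mem (N : SignInvariantNorm d) (a : Params) :
    ∀ᵐ u ∂(seedLaw N a), ∀ i, u i ∈ Set.Icc (0 : ℝ) 1 := by
  have := isProbabilityMeasure_uniform
  refine ae_all_iff.mpr fun i => ?_
  exact (measurePreserving_eval (fun _ : testedLevels N a =>
    (volume : Measure ℝ).restrict (Set.Icc 0 1)) i).quasiMeasurePreserving.ae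
      (ae_restrict_mem measurableSet_Icc)

/-- The cells of the samples of the two phases of the heavy hitters call at level `i`. -/
noncomputable def levelCells (N : SignInvariantNorm d) (a : Params) (i : testedLevels N a)
    (x : SampleIdx N a → Fin d → ℝ) : (Fin (levelCand N a i) → Cell d) ×
      (Fin (levelMass N a i) → Cell d) :=
  ((fun j => cellOf i (x ⟨i, Sum.inl j⟩)), (fun j => cellOf i (x ⟨i, Sum.inr j⟩)))

/-- The samples of the heavy hitters call at level `i` are accurate. -/
def LevelAccurate (N : SignInvariantNorm d) (a : Params) (P : Measure (Fin d → ℝ))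
    (i : testedLevels N a) (w : (Fin (levelCand N a i) → Cell d) ×
      (Fin (levelMass N a i) → Cell d)) : Prop :=
  Accurate (P.map (cellOf i)) (grid d i) (target N a i) (target N a i / 2) (a.ρ / a.t) (a.δ / a.t)
    w.1 w.2

lemma map_cellOf_real_singleton (P : Measure (Fin d → ℝ)) (i : ℕ) (c : Cell d) :
    (P.map (cellOf i)).real {c} = cellMass P i c :=
  map_measureReal_apply (measurable_cellOf i) (measurableSet_singleton c)

lemma cellMass_eq_zero (P : Measure (Fin d → ℝ)) {i : ℕ} {c : Cell d} (hc : c ∉ grid d i) :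
    cellMass P i c = 0 := by
  have : cellOf (d := d) i ⁻¹' {c} = ∅ :=
    Set.eq_empty_iff_forall_notMem.mpr fun y hy => hc (hy ▸ cellOf_mem_grid i y)
  rw [cellMass, this, measureReal_empty]

lemma measurePreserving_levelCells (N : SignInvariantNorm d) (a : Params)
    (P : Measure (Fin d → ℝ)) [IsProbabilityMeasure P] (i : testedLevels N a) :
    MeasurePreserving (levelCells N a i) (Measure.pi fun _ : SampleIdx N a => P)
      ((Measure.pi fun _ : Fin (levelCand N a i) => P.map (cellOf i)).prod
        (Measure.pi fun _ : Fin (levelMass N a i) => P.map (cellOf i))) :=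
  measurePreserving_pi_comp_sum P (e := fun s => (⟨i, s⟩ : SampleIdx N a)) (fun s s' h => by simpa using h)
    (measurable_cellOf _)

/-! ### Accuracy of all levels and replicability. -/

section Accuracy

variable {N : SignInvariantNorm d} {a : Params}

lemma measure_not_levelAccurate_le (hγ : 0 < gamma N a) (hΛ : 0 < a.Λ) (hρ : 0 < a.ρ)
    (hδ : 0 < a.δ) (hδ1 : a.δ < 1) (P : Measure (Fin d → ℝ)) [IsProbabilityMeasure P]
    (i : testedLevels N a) :
    (Measure.pi fun _ : SampleIdx N a => P) {x | ¬ LevelAccurate N a P i (levelCells N a i x)} ≤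
      ENNReal.ofReal (a.δ / a.t) := by
  have : IsProbabilityMeasure (P.map (cellOf (d := d) i)) :=
    Measure.isProbabilityMeasure_map (measurable_cellOf _).aemeasurable
  obtain ⟨hi1, hit⟩ := mem_Icc_of_mem_testedLevels i.2
  have ht1 : (1 : ℝ) ≤ a.t := by exact_mod_cast hi1.trans hit
  have ht0 : (0 : ℝ) < a.t := by linarith
  have hv := target_pos (N := N) hγ hΛ i
  have hδt : a.δ / a.t < 1 := by
    rw [div_lt_one ht0]
    linarith
  have h := measure_not_accurate_le (P.map (cellOf (d := d) i)) (grid d i)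
    (fun c hc => by rw [map_cellOf_real_singleton, cellMass_eq_zero P hc])
    (v := target N a i) (ε := target N a i / 2) (ρ := a.ρ / a.t) (δ := a.δ / a.t)
    (by linarith) (by linarith) (by positivity) (by positivity) hδt
  refine le_trans (le_of_eq ?_) h
  exact (measurePreserving_levelCells N a P i).measure_preimage
    (Set.to_countable {w | ¬ LevelAccurate N a P i w}).measurableSet.nullMeasurableSet

/-- Either one of the two runs is inaccurate, or the threshold separates them. Each run enters
through its tuple of sampled cells, which has countably many values, so the fiber bound applies. -/
lemma measure_levelHeavy_ne_le (hγ : 0 < gamma N a) (hΛ : 0 < a.Λ) (hρ : 0 < a.ρ)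
    (hρ1 : a.ρ < 1) (hδ : 0 < a.δ) (hδρ : a.δ < a.ρ / 3) (P : Measure (Fin d → ℝ))
    [IsProbabilityMeasure P] (i : testedLevels N a) :
    (((Measure.pi fun _ : SampleIdx N a => P).prod (Measure.pi fun _ : SampleIdx N a => P)).prod
      (seedLaw N a)) {w | levelHeavy N a w.1.1 w.2 i ≠ levelHeavy N a w.1.2 w.2 i} ≤
      ENNReal.ofReal (a.ρ / a.t) := by
  have := isProbabilityMeasure_seedLaw N a
  obtain ⟨hi1, hit⟩ := mem_Icc_of_mem_testedLevels i.2
  have ht1 : (1 : ℝ) ≤ a.t := by exact_mod_cast hi1.trans hit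
  have ht0 : (0 : ℝ) < a.t := by linarith
  have hv := target_pos (N := N) hγ hΛ i
  have hρt : a.ρ / a.t ≤ 1 := by
    rw [div_le_one ht0]
    linarith
  set μ := Measure.pi fun _ : SampleIdx N a => P with hμ
  set A := LevelAccurate N a P i with hA
  have hbad := measure_not_levelAccurate_le hγ hΛ hρ hδ (by linarith) P i
  rw [← hμ] at hbad
  have hm := (measurePreserving_levelCells N a P i).measurable
  have hgood := prod_le_of_forall_fiber (μ.prod μ) (seedLaw N a)
    (f := fun w => (levelCells N a i w.1, levelCells N a i w.2))
    ((hm.comp measurable_fst).prodMk (hm.comp measurable_snd))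
    (fun g u => A g.1 ∧ A g.2 ∧
      heavyHitters (grid d i) (target N a i) (target N a i / 2) (a.ρ / a.t) (a.δ / a.t)
        g.1.1 g.1.2 (u i) ≠
      heavyHitters (grid d i) (target N a i) (target N a i / 2) (a.ρ / a.t) (a.δ / a.t)
        g.2.1 g.2.2 (u i))
    (r := ENNReal.ofReal (a.ρ / a.t / 3)) (by
      intro g
      by_cases hg : A g.1 ∧ A g.2
      · refine le_trans (measure_mono ?_) ((seedLaw_eval_le N a i _).trans
          (measure_heavyHitters_ne_le hg.1 hg.2 (by linarith) (by positivity) hρt))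
        exact fun u hu => hu.2.2
      · refine le_trans (le_of_eq ?_) zero_le
        have : {u : Seed N a | A g.1 ∧ A g.2 ∧
            heavyHitters (grid d i) (target N a i) (target N a i / 2) (a.ρ / a.t) (a.δ / a.t)
              g.1.1 g.1.2 (u i) ≠
            heavyHitters (grid d i) (target N a i) (target N a i / 2) (a.ρ / a.t) (a.δ / a.t)
              g.2.1 g.2.2 (u i)} = ∅ :=
          Set.eq_empty_iff_forall_notMem.mpr fun u hu => hg ⟨hu.1, hu.2.1⟩
        rw [this, measure_empty])
  set B := {x | ¬ A (levelCells N a i x)} with hB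
  have hsub : {w : ((SampleIdx N a → Fin d → ℝ) × (SampleIdx N a → Fin d → ℝ)) × Seed N a |
      levelHeavy N a w.1.1 w.2 i ≠ levelHeavy N a w.1.2 w.2 i} ⊆
      ((B ×ˢ Set.univ) ×ˢ Set.univ ∪ (Set.univ ×ˢ B) ×ˢ Set.univ) ∪
      {w | A (levelCells N a i w.1.1) ∧ A (levelCells N a i w.1.2) ∧
        levelHeavy N a w.1.1 w.2 i ≠ levelHeavy N a w.1.2 w.2 i} := by
    intro w hw
    by_cases h1 : A (levelCells N a i w.1.1)
    · by_cases h2 : A (levelCells N a i w.1.2)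
      · exact Or.inr ⟨h1, h2, hw⟩
      · exact Or.inl (Or.inr ⟨⟨trivial, h2⟩, trivial⟩)
    · exact Or.inl (Or.inl ⟨⟨h1, trivial⟩, trivial⟩)
  have hb1 : ((μ.prod μ).prod (seedLaw N a)) ((B ×ˢ Set.univ) ×ˢ Set.univ) ≤
      ENNReal.ofReal (a.δ / a.t) := by
    rw [Measure.prod_prod, Measure.prod_prod, measure_univ, measure_univ, mul_one, mul_one]
    exact hbad
  have hb2 : ((μ.prod μ).prod (seedLaw N a)) ((Set.univ ×ˢ B) ×ˢ Set.univ) ≤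
      ENNReal.ofReal (a.δ / a.t) := by
    rw [Measure.prod_prod, Measure.prod_prod, measure_univ, measure_univ, mul_one, one_mul]
    exact hbad
  refine (measure_mono hsub).trans ((measure_union_le _ _).trans
    ((add_le_add ((measure_union_le _ _).trans (add_le_add hb1 hb2)) hgood).trans ?_))
  rw [← ENNReal.ofReal_add (by positivity) (by positivity),
    ← ENNReal.ofReal_add (by positivity) (by positivity)]
  refine ENNReal.ofReal_le_ofReal ?_
  -- This is where `δ < ρ/3` is needed: two accuracy failures and the threshold event get `ρ/(3t)`
  -- each.
  have : a.δ / a.t ≤ a.ρ / a.t / 3 := by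
    rw [div_right_comm]
    gcongr
  linarith

lemma heavyCells_congr {x x' : SampleIdx N a → Fin d → ℝ} {u : Seed N a}
    (h : ∀ i, levelHeavy N a x u i = levelHeavy N a x' u i) :
    heavyCells N a x u = heavyCells N a x' u := by
  funext i
  induction i with
  | zero => rfl
  | succ i ih => simp only [heavyCells, ih, h]

lemma rCoreset_eq_repMap {D : Set (Fin d → ℝ)} (ch : ChoiceRule d D)
    (x : SampleIdx N a → Fin d → ℝ) (u : Seed N a) :
    rCoreset N a ch x u = repMap ch (heavyCells N a x u) a.t := rfl

lemma sum_testedLevels_ofReal_le (N : SignInvariantNorm d) (a : Params) {r : ℝ} (hr : 0 ≤ r) :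
    ∑ _i : testedLevels N a, ENNReal.ofReal (r / a.t) ≤ ENNReal.ofReal r := by
  rw [Finset.sum_const, Finset.card_univ, Fintype.card_coe, nsmul_eq_mul, ← ENNReal.ofReal_natCast,
    ← ENNReal.ofReal_mul (by positivity)]
  refine ENNReal.ofReal_le_ofReal ?_
  have h : ((testedLevels N a).card : ℝ) ≤ a.t := by exact_mod_cast card_testedLevels_le N a
  rw [← mul_div_assoc]
  refine div_le_of_le_mul₀ (by positivity) hr ?_
  rw [mul_comm]
  gcongr

/-- Runs with equal heavy hitters at every tested level give the same tree and hence the same map,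
since the choice rule ignores the data; there are at most `t` such levels. -/
theorem isReplicable_rCoreset (hγ : 0 < gamma N a) (hΛ : 0 < a.Λ) (hρ : 0 < a.ρ)
    (hρ1 : a.ρ < 1) (hδ : 0 < a.δ) (hδρ : a.δ < a.ρ / 3) {D : Set (Fin d → ℝ)}
    (ch : ChoiceRule d D) : IsReplicable (seedLaw N a) (rCoreset N a ch) a.ρ := by
  intro P _
  have hsub : {w : ((SampleIdx N a → Fin d → ℝ) × (SampleIdx N a → Fin d → ℝ)) × Seed N a |
      rCoreset N a ch w.1.1 w.2 ≠ rCoreset N a ch w.1.2 w.2} ⊆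
      ⋃ i, {w | levelHeavy N a w.1.1 w.2 i ≠ levelHeavy N a w.1.2 w.2 i} := by
    intro w hw
    by_contra hcon
    refine hw ?_
    rw [rCoreset_eq_repMap, rCoreset_eq_repMap, heavyCells_congr fun i => ?_]
    by_contra hne
    exact hcon (Set.mem_iUnion.mpr ⟨i, hne⟩)
  refine (measure_mono hsub).trans ((measure_iUnion_fintype_le _ _).trans ?_)
  exact (Finset.sum_le_sum fun i _ => measure_levelHeavy_ne_le hγ hΛ hρ hρ1 hδ hδρ P i).trans
    (sum_testedLevels_ofReal_le N a hρ.le)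

/-! ### The tree of heavy cells of a good run -/

lemma isCellTree_heavyCells (ht : 1 ≤ a.t)
    (htop : (2 : ℝ) ^ (1 - (a.t : ℤ)) * N.diam ≤ a.ε * a.Λ / 5)
    (x : SampleIdx N a → Fin d → ℝ) (u : Seed N a) :
    IsCellTree (heavyCells N a x u) a.t where
  zero := rfl
  succ_subset i := by
    rw [heavyCells]
    split_ifs
    · exact Finset.inter_subset_left
    · exact Finset.empty_subset _
  eq_empty i hi := by
    obtain ⟨i, rfl⟩ : ∃ j, i = j + 1 := ⟨i - 1, by omega⟩
    rw [heavyCells, dif_neg]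
    intro htest
    obtain ⟨-, hle⟩ := mem_Icc_of_mem_testedLevels htest
    -- Only level `t` itself remains, and there `htop` contradicts the condition for being tested.
    have hti : a.t = i + 1 := by omega
    rw [hti] at htop
    exact absurd (Finset.mem_filter.mp htest).2 (not_lt.mpr htop)

lemma mem_heavyCells_succ {x : SampleIdx N a → Fin d → ℝ} {u : Seed N a} {i : ℕ} {c : Cell d}
    (hc : c ∈ heavyCells N a x u (i + 1)) :
    ∃ h : i + 1 ∈ testedLevels N a, c ∈ levelHeavy N a x u ⟨i + 1, h⟩ := by
  rw [heavyCells] at hc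
  split_ifs at hc with h
  · exact ⟨h, (Finset.mem_inter.mp hc).2⟩
  · simp at hc

/-- The runs of the algorithm in which all heavy hitters calls are accurate. -/
structure GoodRun (N : SignInvariantNorm d) (a : Params) (P : Measure (Fin d → ℝ))
    (X : Set (Fin d → ℝ)) (x : SampleIdx N a → Fin d → ℝ) (u : Seed N a) : Prop where
  accurate : ∀ i, LevelAccurate N a P i (levelCells N a i x)
  seed_mem : ∀ i, u i ∈ Set.Icc (0 : ℝ) 1
  sample_mem : ∀ s, x s ∈ X

lemma measure_not_goodRun_le (hγ : 0 < gamma N a) (hΛ : 0 < a.Λ) (hρ : 0 < a.ρ)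
    (hδ : 0 < a.δ) (hδ1 : a.δ < 1) (P : Measure (Fin d → ℝ)) [IsProbabilityMeasure P]
    {X : Set (Fin d → ℝ)} (hPX : ∀ᵐ x ∂P, x ∈ X) :
    ((Measure.pi fun _ : SampleIdx N a => P).prod (seedLaw N a))
      {w | ¬ GoodRun N a P X w.1 w.2} ≤ ENNReal.ofReal a.δ := by
  have := isProbabilityMeasure_seedLaw N a
  have hX : ∀ᵐ x ∂(Measure.pi fun _ : SampleIdx N a => P), ∀ s, x s ∈ X :=
    ae_all_iff.mpr fun s =>
      (measurePreserving_eval (fun _ : SampleIdx N a => P) s).quasiMeasurePreserving.ae hPX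
  have hU := ae_seedLaw_mem N a
  have hsub : {w : (SampleIdx N a → Fin d → ℝ) × Seed N a | ¬ GoodRun N a P X w.1 w.2} ⊆
      (⋃ i, {x | ¬ LevelAccurate N a P i (levelCells N a i x)} ×ˢ Set.univ) ∪
      ({x | ¬ ∀ s, x s ∈ X} ×ˢ Set.univ ∪
        Set.univ ×ˢ {u : Seed N a | ¬ ∀ i, u i ∈ Set.Icc (0 : ℝ) 1}) := by
    intro w hw
    by_cases h1 : ∀ i, LevelAccurate N a P i (levelCells N a i w.1)
    · by_cases h2 : ∀ s, w.1 s ∈ X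
      · exact Or.inr (Or.inr ⟨trivial, fun h3 => hw ⟨h1, h3, h2⟩⟩)
      · exact Or.inr (Or.inl ⟨h2, trivial⟩)
    · obtain ⟨i, hi⟩ := not_forall.mp h1
      exact Or.inl (Set.mem_iUnion.mpr ⟨i, hi, trivial⟩)
  have h1 : ((Measure.pi fun _ : SampleIdx N a => P).prod (seedLaw N a))
      (⋃ i, {x | ¬ LevelAccurate N a P i (levelCells N a i x)} ×ˢ Set.univ) ≤
      ENNReal.ofReal a.δ := by
    refine (measure_iUnion_fintype_le _ _).trans
      ((Finset.sum_le_sum fun i _ => ?_).trans (sum_testedLevels_ofReal_le N a hδ.le))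
    rw [Measure.prod_prod, measure_univ, mul_one]
    exact measure_not_levelAccurate_le hγ hΛ hρ hδ hδ1 P i
  have h2 : ((Measure.pi fun _ : SampleIdx N a => P).prod (seedLaw N a))
      ({x | ¬ ∀ s, x s ∈ X} ×ˢ Set.univ ∪
        Set.univ ×ˢ {u : Seed N a | ¬ ∀ i, u i ∈ Set.Icc (0 : ℝ) 1}) = 0 := by
    refine measure_union_null ?_ ?_
    · rw [Measure.prod_prod, ae_iff.mp hX, zero_mul]
    · rw [Measure.prod_prod, ae_iff.mp hU, mul_zero]
  refine (measure_mono hsub).trans ((measure_union_le _ _).trans ?_)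
  rw [h2, add_zero]
  exact h1

section GoodRun

variable {P : Measure (Fin d → ℝ)} {X : Set (Fin d → ℝ)} {x : SampleIdx N a → Fin d → ℝ}
  {u : Seed N a}

lemma GoodRun.le_cellMass (h : GoodRun N a P X x u) (hγ : 0 < gamma N a) (hΛ : 0 < a.Λ)
    (hρ1 : a.ρ < 1) {i : ℕ} (hi : 1 ≤ i) {c : Cell d} (hc : c ∈ heavyCells N a x u i) :
    target N a i / 2 ≤ cellMass P i c := by
  obtain ⟨i, rfl⟩ : ∃ j, i = j + 1 := ⟨i - 1, by omega⟩
  obtain ⟨htest, hc⟩ := mem_heavyCells_succ hc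
  obtain ⟨hi1, hit⟩ := mem_Icc_of_mem_testedLevels htest
  have ht1 : (1 : ℝ) ≤ a.t := by exact_mod_cast hi1.trans hit
  have hv := target_pos (N := N) hγ hΛ (i + 1)
  have := (h.accurate ⟨i + 1, htest⟩).le_mass_of_mem (by simpa using hv)
    ((div_le_one (by linarith)).mpr (by linarith)) (h.seed_mem ⟨i + 1, htest⟩).1 hc
  rw [map_cellOf_real_singleton] at this
  linarith

lemma GoodRun.cellMass_le (h : GoodRun N a P X x u) (hγ : 0 < gamma N a) (hΛ : 0 < a.Λ)
    (hρ1 : a.ρ < 1) {i : ℕ} (htest : i + 1 ∈ testedLevels N a) {c : Cell d}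
    (hc : c ∈ children i (heavyCells N a x u i)) (hc' : c ∉ heavyCells N a x u (i + 1)) :
    cellMass P (i + 1) c ≤ target N a (i + 1) := by
  obtain ⟨hi1, hit⟩ := mem_Icc_of_mem_testedLevels htest
  have ht1 : (1 : ℝ) ≤ a.t := by exact_mod_cast hi1.trans hit
  have hv := target_pos (N := N) hγ hΛ (i + 1)
  rw [heavyCells, dif_pos htest, Finset.mem_inter] at hc'
  have hc'' : c ∉ levelHeavy N a x u ⟨i + 1, htest⟩ := fun hh => hc' ⟨hc, hh⟩
  have := (h.accurate ⟨i + 1, htest⟩).mass_lt_of_notMem (by simpa using hv)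
    ((div_le_one (by linarith)).mpr (by linarith)) (h.seed_mem ⟨i + 1, htest⟩).2 hc''
  rw [map_cellOf_real_singleton] at this
  exact this.le

/-- A returned cell has positive empirical mass, so it contains one of the samples, which lie in `X
⊆ D`. -/
lemma GoodRun.region_inter_nonempty (h : GoodRun N a P X x u) (hγ : 0 < gamma N a) (hΛ : 0 < a.Λ)
    (hXB : X ⊆ N.ball) {D : Set (Fin d → ℝ)} (hXD : X ⊆ D) {i : ℕ} (hi : 1 ≤ i) {c : Cell d}
    (hc : c ∈ heavyCells N a x u i) : (region d i c ∩ D).Nonempty := by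
  obtain ⟨i, rfl⟩ : ∃ j, i = j + 1 := ⟨i - 1, by omega⟩
  obtain ⟨htest, hc⟩ := mem_heavyCells_succ hc
  have hv := target_pos (N := N) hγ hΛ (i + 1)
  have hu := (h.seed_mem ⟨i + 1, htest⟩).1
  obtain ⟨-, hthr⟩ := Finset.mem_filter.mp hc
  have hpos := lt_of_lt_of_le (show 0 < target N a (i + 1) - 2 / 3 * (target N a (i + 1) / 2) +
    u ⟨i + 1, htest⟩ * (target N a (i + 1) / 2 / 3) by
      have : 0 ≤ u ⟨i + 1, htest⟩ * (target N a (i + 1) / 2 / 3) := by positivity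
      linarith) hthr
  rw [empirical] at hpos
  have hcard : (Finset.univ.filter _).card ≠ 0 := fun h0 => by
    rw [h0] at hpos
    simp at hpos
  obtain ⟨j, hj⟩ := Finset.card_ne_zero.mp hcard
  have hj := (Finset.mem_filter.mp hj).2.2
  have hxX := h.sample_mem ⟨⟨i + 1, htest⟩, Sum.inr j⟩
  exact ⟨_, ⟨fun l => N.ball_subset_cube (hXB hxX) l, hj⟩, hXD hxX⟩

end GoodRun

end Accuracy

/-! ### Numbers of layers and samples -/

/-- Rounding gives `t ≤ 20β + 2 log z`, and `log z ≥ log 2 > 1/2` absorbs the additive term. -/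
lemma layers_le {β z : ℝ} (hβ : 1 ≤ β) (hz : 2 ≤ z) {t : ℕ}
    (ht : (t : ℤ) ≤ ⌈Real.logb 2 (10 * β * z) + 1⌉) : (t : ℝ) ≤ 46 * β * Real.log z := by
  have h1 : (t : ℝ) ≤ (⌈Real.logb 2 (10 * β * z) + 1⌉ : ℤ) := by exact_mod_cast ht
  have h2 := Int.ceil_lt_add_one (Real.logb 2 (10 * β * z) + 1)
  have hl2 : (1 : ℝ) / 2 < Real.log 2 := by linarith [Real.log_two_gt_d9]
  have hlz : Real.log 2 ≤ Real.log z := Real.log_le_log (by norm_num) hz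
  have hlb : Real.log (10 * β) ≤ 10 * β - 1 := Real.log_le_sub_one_of_pos (by linarith)
  have h3 : Real.logb 2 (10 * β * z) ≤ 2 * (10 * β - 1) + 2 * Real.log z := by
    rw [Real.logb, Real.log_mul (by linarith) (by linarith), div_le_iff₀ (by linarith)]
    nlinarith
  nlinarith

lemma candReal_le {w δ g : ℝ} (hw : 0 < w) (hδ : 0 < δ) (hg : 1 / w ≤ g)
    (hL : 0 ≤ Real.log (2 * g / δ)) : candReal (2 * w) w δ ≤ g * Real.log (2 * g / δ) := by
  have h1 : Real.log (2 / (δ * w)) ≤ Real.log (2 * g / δ) := by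
    refine Real.log_le_log (by positivity) ?_
    calc 2 / (δ * w) = 2 * (1 / w) / δ := by field_simp
      _ ≤ _ := by gcongr
  rw [candReal, two_mul, add_sub_cancel_right]
  calc Real.log (2 / (δ * w)) / w ≤ Real.log (2 * g / δ) / w := by gcongr
    _ = 1 / w * Real.log (2 * g / δ) := by ring
    _ ≤ _ := by gcongr

section Counts

variable {α : Type*}

lemma candCount_le_candBound (dom : Finset α) (v ε δ : ℝ) :
    candCount dom v ε δ ≤ candBound dom v ε δ := by
  unfold candCount candBound
  split_ifs <;> simp

lemma candBound_le (dom : Finset α) {v ε δ r : ℝ} (hr : 0 ≤ r) (h : candReal v ε δ ≤ r) :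
    (candBound dom v ε δ : ℝ) ≤ r + 1 := by
  unfold candBound
  split_ifs with hs
  · linarith
  · exact (Nat.cast_le.mpr (Nat.ceil_le_ceil h)).trans (Nat.ceil_lt_add_one hr).le

end Counts

lemma massCount_le {ρ w δ g L : ℝ} {n : ℕ} (hρ : 0 < ρ) (hw : 0 < w) (hg : 1 / w ≤ g)
    (hg1 : 1 ≤ g) (hL1 : 1 ≤ L) (hδ : 0 < δ) (hδ2 : δ ≤ 2) (hlog : Real.log (2 / δ) ≤ L)
    (hn : (n : ℝ) ≤ g * L + 1) : (massCount ρ w δ n : ℝ) ≤ 2592 * g ^ 3 * L / ρ ^ 2 + 1 := by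
  have hl2 : Real.log 2 ≤ 1 := by linarith [Real.log_two_lt_d9]
  have hl2' : 0 < Real.log 2 := Real.log_pos (by norm_num)
  have hl0 : 0 ≤ Real.log (2 / δ) := Real.log_nonneg (by rw [le_div_iff₀ hδ]; linarith)
  have hgL : 1 ≤ g * L := one_le_mul_of_one_le_of_one_le hg1 hL1
  have hLg : L ≤ g * L := le_mul_of_one_le_left (by linarith) hg1
  -- The two logarithmic terms are at most `gL` and `gL + 2 ≤ 3gL`, whence `2592 = 4 · 648`.
  have hnum : 648 * Real.log (2 / δ) + 648 * ((n : ℝ) + 1) * Real.log 2 ≤ 2592 * (g * L) := by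
    have : ((n : ℝ) + 1) * Real.log 2 ≤ g * L + 2 := by
      calc ((n : ℝ) + 1) * Real.log 2 ≤ ((n : ℝ) + 1) * 1 := by gcongr
        _ ≤ _ := by linarith
    nlinarith
  have h0 : 0 ≤ (648 * Real.log (2 / δ) + 648 * ((n : ℝ) + 1) * Real.log 2) / (ρ ^ 2 * w ^ 2) := by
    positivity
  refine (Nat.ceil_lt_add_one h0).le.trans (add_le_add ?_ le_rfl)
  calc _ ≤ 2592 * (g * L) / (ρ ^ 2 * w ^ 2) := by gcongr
    _ = 2592 * (g * L) / ρ ^ 2 * (1 / w) ^ 2 := by field_simp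
    _ ≤ 2592 * (g * L) / ρ ^ 2 * g ^ 2 := by gcongr
    _ = _ := by ring

/-- Since `i ≥ 1`, the accuracy `w = γΛ2^i/2` is at least `γΛ`, so a single `g` serves all levels.
The constant is `2592 + 3`, three further terms being at most `B`. -/
lemma level_samples_le {N : SignInvariantNorm d} {a : Params} {i : ℕ} {g L : ℝ}
    (hγΛ : 0 < gamma N a * a.Λ) (hg : 1 / (gamma N a * a.Λ) ≤ g) (hg1 : 1 ≤ g) (hi : 1 ≤ i)
    (ht : 1 ≤ a.t) (hρ : 0 < a.ρ) (hρ1 : a.ρ < 1) (hδ : 0 < a.δ) (hδ1 : a.δ < 1)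
    (hL : L = Real.log (2 * g / (a.δ / a.t))) (hL1 : 1 ≤ L) :
    (levelCand N a i : ℝ) + levelMass N a i ≤ 2595 * a.t ^ 2 * g ^ 3 * L / a.ρ ^ 2 := by
  have ht1 : (1 : ℝ) ≤ a.t := by exact_mod_cast ht
  have ht0 : (0 : ℝ) < a.t := by linarith
  set w := target N a i / 2 with hw
  have hwle : gamma N a * a.Λ ≤ w := by
    have : (2 : ℝ) ≤ 2 ^ i := le_self_pow₀ (by norm_num) (by omega)
    rw [hw, target]
    nlinarith
  have hw0 : 0 < w := by linarith
  have hv : target N a i = 2 * w := by rw [hw]; ring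
  have hgw : 1 / w ≤ g := (one_div_le_one_div_of_le hγΛ hwle).trans hg
  have hδt : 0 < a.δ / a.t := by positivity
  have hδt1 : a.δ / a.t ≤ 1 := (div_le_one ht0).mpr (by linarith)
  have hcand : candReal (target N a i) w (a.δ / a.t) ≤ g * L := by
    rw [hv, hL]
    exact candReal_le hw0 hδt hgw (by linarith)
  have hbound := candBound_le (grid d i) (by positivity) hcand
  have hcount : (levelCand N a i : ℝ) ≤ g * L + 1 :=
    (Nat.cast_le.mpr (candCount_le_candBound _ _ _ _)).trans hbound
  have hlog : Real.log (2 / (a.δ / a.t)) ≤ L := by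
    rw [hL]
    refine Real.log_le_log (by positivity) ?_
    gcongr
    linarith
  have hmass : (levelMass N a i : ℝ) ≤ 2592 * g ^ 3 * L / (a.ρ / a.t) ^ 2 + 1 :=
    massCount_le (by positivity) hw0 hgw hg1 hL1 hδt (by linarith) hlog hbound
  set B := a.t ^ 2 * g ^ 3 * L / a.ρ ^ 2 with hB
  have e1 : 2592 * g ^ 3 * L / (a.ρ / a.t) ^ 2 = 2592 * B := by rw [hB]; field_simp
  have e2 : 2595 * a.t ^ 2 * g ^ 3 * L / a.ρ ^ 2 = 2595 * B := by rw [hB]; ring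
  have hgL : 1 ≤ g * L := one_le_mul_of_one_le_of_one_le hg1 hL1
  have hgB : g * L ≤ B := by
    rw [hB, le_div_iff₀ (by positivity)]
    calc g * L * a.ρ ^ 2 ≤ g * L * 1 := by gcongr; exact pow_le_one₀ hρ.le hρ1.le
      _ = 1 * g ^ 1 * L := by ring
      _ ≤ a.t ^ 2 * g ^ 3 * L := by
        gcongr
        · exact one_le_pow₀ ht1
        · norm_num
  rw [e1] at hmass
  rw [e2]
  linarith

lemma card_sampleIdx_le {N : SignInvariantNorm d} {a : Params} {g L : ℝ}
    (hγΛ : 0 < gamma N a * a.Λ) (hg : 1 / (gamma N a * a.Λ) ≤ g) (hg1 : 1 ≤ g)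
    (ht : 1 ≤ a.t) (hρ : 0 < a.ρ) (hρ1 : a.ρ < 1) (hδ : 0 < a.δ) (hδ1 : a.δ < 1)
    (hL : L = Real.log (2 * g / (a.δ / a.t))) (hL1 : 1 ≤ L) :
    (Fintype.card (SampleIdx N a) : ℝ) ≤ 2595 * a.t ^ 3 * g ^ 3 * L / a.ρ ^ 2 := by
  have hcard : (Fintype.card (SampleIdx N a) : ℝ) =
      ∑ i : testedLevels N a, ((levelCand N a i : ℝ) + levelMass N a i) := by
    simp [SampleIdx, Fintype.card_sigma]
  rw [hcard]
  refine (Finset.sum_le_card_nsmul _ _ _ fun i _ =>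
    level_samples_le hγΛ hg hg1 (mem_Icc_of_mem_testedLevels i.2).1 ht hρ hρ1 hδ hδ1 hL hL1).trans ?_
  rw [nsmul_eq_mul, Finset.card_univ, Fintype.card_coe]
  have h : ((testedLevels N a).card : ℝ) ≤ a.t := by exact_mod_cast card_testedLevels_le N a
  calc _ ≤ (a.t : ℝ) * (2595 * a.t ^ 2 * g ^ 3 * L / a.ρ ^ 2) := by gcongr
    _ = _ := by ring

/-- The six factors `t` and the logarithm of the confidence each cost one factor `m = log f`, which
gives the exponent `7`; the power `β^10` is `3 + 6 + 1`. -/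
lemma sample_bound {β t A z δ ρ : ℝ} (hβ : 1 ≤ β) (ht1 : 1 ≤ t) (hz : 2 ≤ z) (hzA : z ≤ A)
    (ht : t ≤ 46 * β * Real.log z) (hρ : 0 < ρ) (hρ1 : ρ < 1) (hδ : 0 < δ) (hδ3 : δ < 1 / 3) :
    2595 * t ^ 3 * (20 * β * t * A) ^ 3 * Real.log (2 * (20 * β * t * A) / (δ / t)) / ρ ^ 2 ≤
      2595 * 8000 * 46 ^ 6 * 134 * β ^ 10 * (A ^ 3 / ρ ^ 2 * Real.log (1 / δ)) *
        Real.log (A ^ 3 / ρ ^ 2 * Real.log (1 / δ)) ^ 7 := by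
  have hA2 : 2 ≤ A := hz.trans hzA
  have hA0 : 0 < A := by linarith
  have hβ0 : 0 < β := by linarith
  have ht0 : 0 < t := by linarith
  have hexp3 : Real.exp 1 ≤ 3 := by linarith [Real.exp_one_lt_d9]
  set l := Real.log (1 / δ) with hl
  have hl1 : 1 ≤ l := by
    rw [hl, Real.le_log_iff_exp_le (by positivity), le_div_iff₀ hδ]
    nlinarith
  set f := A ^ 3 / ρ ^ 2 * l with hf
  have hAf3 : A ^ 3 ≤ f := by
    calc A ^ 3 = A ^ 3 / 1 * 1 := by ring
      _ ≤ A ^ 3 / ρ ^ 2 * l := by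
        gcongr
        exact pow_le_one₀ hρ.le hρ1.le
  have hA3 : A * 4 ≤ A ^ 3 := by
    nlinarith [mul_nonneg hA0.le (mul_nonneg (sub_nonneg.mpr hA2) (by linarith : 0 ≤ A + 2))]
  have hAf : A ≤ f := by linarith
  have hf0 : 0 < f := by linarith
  set m := Real.log f with hm
  have hm1 : 1 ≤ m := by
    rw [hm, Real.le_log_iff_exp_le hf0]
    linarith
  have hlA : Real.log A ≤ m := Real.log_le_log hA0 hAf
  have htm : t ≤ 46 * β * m := by
    refine ht.trans ?_
    gcongr
    exact (Real.log_le_log (by linarith) hzA).trans hlA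
  -- The constant is `134 = 40 + 2 · 46 + 1 + 1`, from the factors `40β`, `t²`, `A` and `1/δ`.
  have hL : Real.log (2 * (20 * β * t * A) / (δ / t)) ≤ 134 * β * (m * l) := by
    have e : 2 * (20 * β * t * A) / (δ / t) = (40 * β) * (t * t) * A * (1 / δ) := by
      field_simp; ring
    rw [e, Real.log_mul (by positivity) (by positivity), Real.log_mul (by positivity) hA0.ne',
      Real.log_mul (by positivity) (by positivity), Real.log_mul ht0.ne' ht0.ne', ← hl]
    have h1 : Real.log (40 * β) ≤ 40 * β := by
      linarith [Real.log_le_sub_one_of_pos (show 0 < 40 * β by positivity)]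
    have h2 : Real.log t ≤ t := by linarith [Real.log_le_sub_one_of_pos ht0]
    have hml : 1 ≤ m * l := one_le_mul_of_one_le_of_one_le hm1 hl1
    have hmml : m ≤ m * l := le_mul_of_one_le_right (by linarith) hl1
    have hlml : l ≤ m * l := le_mul_of_one_le_left (by linarith) hm1
    have h3 : β * 1 ≤ β * (m * l) := by gcongr
    have h4 : β * m ≤ β * (m * l) := by gcongr
    have h5 : 1 * (m * l) ≤ β * (m * l) := by gcongr
    linarith
  calc 2595 * t ^ 3 * (20 * β * t * A) ^ 3 * Real.log (2 * (20 * β * t * A) / (δ / t)) / ρ ^ 2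
      = 2595 * 8000 * β ^ 3 * t ^ 6 * (A ^ 3 / ρ ^ 2) *
          Real.log (2 * (20 * β * t * A) / (δ / t)) := by ring
    _ ≤ 2595 * 8000 * β ^ 3 * t ^ 6 * (A ^ 3 / ρ ^ 2) * (134 * β * (m * l)) := by
        gcongr
    _ ≤ 2595 * 8000 * β ^ 3 * (46 * β * m) ^ 6 * (A ^ 3 / ρ ^ 2) * (134 * β * (m * l)) := by
        gcongr
    _ = _ := by rw [hf]; ring

end QuadCoreset

/-! ### Assembly of the theorem. -/

theorem mainTheorem10 (β : ℝ) (hβ : 1 ≤ β) :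
    ∃ C : ℝ, 0 < C ∧ ∃ c : ℕ,
      ∀ (d : ℕ) (N : SignInvariantNorm d)
        (X D : Set (Fin d → ℝ)) (_hXB : X ⊆ N.ball) (_hXD : X ⊆ D)
        (P : Measure (Fin d → ℝ)) (_hP : IsProbabilityMeasure P) (_hPX : ∀ᵐ x ∂P, x ∈ X)
        (a : Params) (_hk : 1 ≤ a.k)
        (_hε : 0 < a.ε) (_hε1 : a.ε < 1) (_hρ : 0 < a.ρ) (_hρ1 : a.ρ < 1)
        (_hδ : 0 < a.δ) (_hδρ : a.δ < a.ρ / 3)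
        (_hopt : 0 < opt N P a.k)
        (_hΛ : opt N P a.k / (β * (1 + a.ε)) ≤ a.Λ) (_hΛ' : a.Λ ≤ (1 + a.ε) * opt N P a.k)
        (_ht : (2 : ℝ) ^ (1 - (a.t : ℤ)) * N.diam ≤ a.ε * a.Λ / 5)
        (_ht' : (a.t : ℤ) ≤ ⌈Real.logb 2 (10 * β * N.diam / (a.ε * opt N P a.k)) + 1⌉)
        (ch : ChoiceRule d D),
        IsReplicable (seedLaw N a) (rCoreset N a ch) a.ρ ∧
        ((Measure.pi fun _ : SampleIdx N a => P).prod (seedLaw N a))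
          {w | ¬ (IsCoreset N D a.k a.ε P (P.map (rCoreset N a ch w.1 w.2))
                    (rCoreset N a ch w.1 w.2 '' X) ∧
                  (rCoreset N a ch w.1 w.2 '' X).Finite ∧
                  ((rCoreset N a ch w.1 w.2 '' X).ncard : ℝ) ≤
                    C * (a.k * 2 ^ (5 * d) * N.diam ^ (d + 1) / a.ε ^ (d + 1) *
                      Real.log (N.diam / (a.ε * opt N P a.k))))} ≤ ENNReal.ofReal a.δ ∧
        (Fintype.card (SampleIdx N a) : ℝ) ≤
          C * (a.k ^ 3 * 2 ^ (15 * d) * N.diam ^ (3 * d + 3) /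
                (a.ρ ^ 2 * a.ε ^ (3 * d + 3) * opt N P a.k ^ 3) * Real.log (1 / a.δ)) *
            Real.log (a.k ^ 3 * 2 ^ (15 * d) * N.diam ^ (3 * d + 3) /
                (a.ρ ^ 2 * a.ε ^ (3 * d + 3) * opt N P a.k ^ 3) * Real.log (1 / a.δ)) ^ c := by

  -- The first summand serves the sample bound; the second, `460β² = 10β · 46β`, serves the size
  -- bound.
  refine ⟨2595 * 8000 * 46 ^ 6 * 134 * β ^ 10 + 460 * β ^ 2, by positivity, 7, ?_⟩
  intro d N X D hXB hXD P hP hPX a hk hε hε1 hρ hρ1 hδ hδρ hopt hΛ hΛ' htop ht' ch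
  have hβ0 : 0 < β := by linarith
  have hd := dim_pos_of_opt_pos N P hk hopt
  have hdiam := N.one_le_diam hd
  have hD0 : 0 < N.diam := by linarith
  have hPB : ∀ᵐ x ∂P, x ∈ N.ball := hPX.mono fun x hx => hXB hx
  have hhalf := opt_le_half N hPB hk hd
  set o := opt N P a.k with ho
  have hΛlow : o / (2 * β) ≤ a.Λ := by
    refine le_trans ?_ hΛ
    gcongr o / ?_
    nlinarith
  have hΛ0 : 0 < a.Λ := lt_of_lt_of_le (by positivity) hΛlow
  -- For `t = 0` the layer condition would read `2Δ ≤ εΛ/5`, whereas `εΛ ≤ 1` and `Δ ≥ 1`.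
  have ht : 1 ≤ a.t := by
    by_contra h0
    have h0 : a.t = 0 := by omega
    rw [h0] at htop
    norm_num at htop
    have : a.ε * a.Λ ≤ 1 * ((1 + 1) * (1 / 2)) := by
      refine mul_le_mul hε1.le (hΛ'.trans ?_) hΛ0.le (by norm_num)
      gcongr
    linarith
  have ht1 : (1 : ℝ) ≤ a.t := by exact_mod_cast ht
  have hk1 : (1 : ℝ) ≤ a.k := by exact_mod_cast hk
  have hγ := gamma_pos N hd a hk ht hε
  set z := N.diam / (a.ε * o) with hz
  have hεo : 0 < a.ε * o := by positivity
  have hz2 : 2 ≤ z := by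
    rw [hz, le_div_iff₀ hεo]
    nlinarith
  have hlogz : 0 < Real.log z := Real.log_pos (by linarith)
  have htz : (a.t : ℝ) ≤ 46 * β * Real.log z := by
    refine layers_le hβ hz2 ?_
    rwa [hz, ← mul_div_assoc]
  set M := (2 ^ 5 / a.ε * N.diam) ^ d with hM
  have hM1 : 1 ≤ M := by
    refine one_le_pow₀ ?_
    have := nearRadius_le (N := N) hd hε hε1
    have : 0 ≤ 10 * N.diam / a.ε := by positivity
    linarith
  have hkM : 1 ≤ a.k * M := one_le_mul_of_one_le_of_one_le hk1 hM1
  have hMexp : M = 2 ^ (5 * d) * N.diam ^ d / a.ε ^ d := by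
    rw [hM, mul_pow, div_pow, ← pow_mul]
    ring
  refine ⟨isReplicable_rCoreset hγ hΛ0 hρ hρ1 hδ hδρ ch, ?_, ?_⟩
  · refine (measure_mono ?_).trans
      (measure_not_goodRun_le (X := X) hγ hΛ0 hρ hδ (by linarith) P hPX)
    intro w hw hgood
    refine hw ?_
    have hH := isCellTree_heavyCells ht htop w.1 w.2
    rw [rCoreset_eq_repMap]
    obtain ⟨hfin, hcard⟩ := hH.ncard_image_le ch X
    refine ⟨hH.isCoreset_repMap ch hd hk ht hε hε1 hΛ0 hXB hXD hPX hΛ'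
      (fun i hi c hc hc' => hgood.cellMass_le hγ hΛ0 hρ1 hi hc hc')
      (fun i hi c hc => hgood.region_inter_nonempty hγ hΛ0 hXB hXD hi hc), hfin, ?_⟩
    have hleaves := hH.card_leaves_le hd hk ht hε hε1 hPB hopt hβ hΛlow
      (fun i hi c hc => hgood.le_cellMass hγ hΛ0 hρ1 hi hc)
    have hsize : a.k * 2 ^ (5 * d) * N.diam ^ (d + 1) / a.ε ^ (d + 1) =
        a.k * M * (N.diam / a.ε) := by
      rw [hMexp]
      field_simp
      ring
    have hquot : 1 ≤ N.diam / a.ε := by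
      rw [le_div_iff₀ hε]
      linarith
    rw [hsize]
    calc ((repMap ch (heavyCells N a w.1 w.2) a.t '' X).ncard : ℝ)
        ≤ ((leaves (heavyCells N a w.1 w.2) a.t).card : ℝ) := by exact_mod_cast hcard
      _ ≤ 10 * β * (a.t * (a.k * M)) := hleaves
      _ ≤ 10 * β * (46 * β * Real.log z * (a.k * M)) := by gcongr
      _ = 460 * β ^ 2 * (a.k * M * 1 * Real.log z) := by ring
      _ ≤ _ := by
        gcongr
        have : 0 ≤ 2595 * 8000 * 46 ^ 6 * 134 * β ^ 10 := by positivity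
        linarith
  · set A := a.k * M * z with hA
    have hzA : z ≤ A := le_mul_of_one_le_left (by linarith) hkM
    have hA0 : 0 < A := by linarith
    -- In terms of `A = kMz` the quantity `f` of the theorem is `(A³/ρ²) log(1/δ)`.
    have hf : a.k ^ 3 * 2 ^ (15 * d) * N.diam ^ (3 * d + 3) /
        (a.ρ ^ 2 * a.ε ^ (3 * d + 3) * o ^ 3) = A ^ 3 / a.ρ ^ 2 := by
      have e1 : (2 : ℝ) ^ (15 * d) = (2 ^ (5 * d)) ^ 3 := by rw [← pow_mul]; ring_nf
      have e2 : N.diam ^ (3 * d + 3) = (N.diam ^ d * N.diam) ^ 3 := by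
        rw [← pow_succ, ← pow_mul]; ring_nf
      have e3 : a.ε ^ (3 * d + 3) = (a.ε ^ d * a.ε) ^ 3 := by
        rw [← pow_succ, ← pow_mul]; ring_nf
      rw [hA, hMexp, hz, e1, e2, e3]
      field_simp
    have hγΛ : 0 < gamma N a * a.Λ := by positivity
    -- By the normalization of `γ`, the product `20βtA · γΛ` equals `2βΛ/OPT`, which is at least `1`
    -- by the lower bound on `Λ`.
    have hg : 1 / (gamma N a * a.Λ) ≤ 20 * β * a.t * A := by
      rw [div_le_iff₀ hγΛ]
      have h1 := gamma_mul N hd a hk ht hε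
      rw [← hM] at h1
      have h2 : 20 * β * a.t * A * (gamma N a * a.Λ) =
          (gamma N a * (a.t * (a.k * M)) * (2 * N.diam)) * (10 * β * a.Λ / (a.ε * o)) := by
        rw [hA, hz]; ring
      have h3 : a.ε / 5 * (10 * β * a.Λ / (a.ε * o)) = a.Λ * (2 * β) / o := by
        field_simp; norm_num
      rw [h2, h1, h3, le_div_iff₀ hopt, one_mul]
      rwa [div_le_iff₀ (by positivity)] at hΛlow
    have hg1 : 1 ≤ 20 * β * a.t * A := by
      have h1 : 1 ≤ β * a.t := one_le_mul_of_one_le_of_one_le hβ ht1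
      have h2 : 1 ≤ β * a.t * A := one_le_mul_of_one_le_of_one_le h1 (by linarith)
      linarith
    have hL1 : 1 ≤ Real.log (2 * (20 * β * a.t * A) / (a.δ / a.t)) := by
      have h3 : 3 ≤ 2 * (20 * β * a.t * A) / (a.δ / a.t) := by
        have h4 : a.δ / a.t ≤ 1 / 3 := by
          refine (div_le_self hδ.le ht1).trans ?_
          linarith
        rw [le_div_iff₀ (by positivity)]
        linarith
      rw [Real.le_log_iff_exp_le (by linarith)]
      linarith [Real.exp_one_lt_d9]
    rw [hf]
    refine (card_sampleIdx_le hγΛ hg hg1 ht hρ hρ1 hδ (by linarith) rfl hL1).trans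
      ((sample_bound hβ ht1 hz2 hzA htz hρ hρ1 hδ (by linarith)).trans ?_)
    have hlog : 0 ≤ Real.log (A ^ 3 / a.ρ ^ 2 * Real.log (1 / a.δ)) ^ 7 := by
      refine pow_nonneg (Real.log_nonneg ?_) 7
      have h1 : 1 ≤ A ^ 3 / a.ρ ^ 2 := by
        rw [le_div_iff₀ (by positivity), one_mul]
        exact (pow_le_one₀ hρ.le hρ1.le).trans (one_le_pow₀ (by linarith))
      have h2 : 1 ≤ Real.log (1 / a.δ) := by
        rw [Real.le_log_iff_exp_le (by positivity), le_div_iff₀ hδ]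
        nlinarith [Real.exp_one_lt_d9]
      exact one_le_mul_of_one_le_of_one_le h1 h2
    have hlogδ : 0 ≤ Real.log (1 / a.δ) :=
      Real.log_nonneg (by rw [le_div_iff₀ hδ]; linarith)
    gcongr
    have : 0 ≤ 460 * β ^ 2 := by positivity
    linarith
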